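/- **Sub-Gamma smoothness.** Let $\mathcal X$ be a set, $N\ge 1$, and let $g_1,\dots,g_N$ be i.i.d. centered Gaussian processes on $\mathcal X$ with covariance $k$ satisfying $k(x,x)=\kappa$ for all $x$. Put $f=-\sum_{j\le N} g_j^2$ and $d(x,y)=2\sqrt{\kappa^2-k(x,y)^2}$. Then $d$ is a pseudo-metric and $f$ is sub-Gamma with parameters $\nu=N$, $c=1$ for $d$: for all $x,y\in\mathcal X$ and $\lambda\ge 0$ with $\lambda d(x,y)<1$, the variable $e^{\lambda(f(x)-f(y))}$ is integrable and $$\log \mathbb E\, e^{\lambda(f(x)-f(y))}\le \frac{N\lambda^2 d(x,y)^2}{2(1-\lambda d(x,y))}.$$ **Regret bound.** Let $a>1$, $u>0$, $D\ge 0$, $R>0$, $\eta>0$, $\kappa$ be real numbers. There is a constant $C$, depending only on $(a,u,D,R,\kappa,\eta)$, such that the following holds for every $N\ge1$, every finite non-empty set $\mathcal X$ (of any cardinality) and every $k$, $g_j$, $f$, $d$ as above for which the covering numbers satisfy $N(\mathcal X,d,\varepsilon)\le (R/\varepsilon)^D$ for all $0<\varepsilon\le R$. Here $N(\mathcal X,d,\varepsilon)$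 is the smallest cardinality of an $\varepsilon$-net, that is, of a subset $T\subseteq\mathcal X$ whose closed $d$-balls of radius $\varepsilon$ cover $\mathcal X$. Let $\Delta=\max_{x,y} d(x,y)$, $\varepsilon_h=\Delta 2^{-h}$, $n_h=2\log N(\mathcal X,d,\varepsilon_h)$, and let $(\mathcal T_h)_{h\ge0}$ be a tree in which $\mathcal T_h\subseteq\mathcal X$ is an $\varepsilon_h$-net with $|\mathcal T_h|\le e^{n_h}$ and the parent of each node of $\mathcal T_{h+1}$ is a $d$-closest element of $\mathcal T_h$. Let $h(i)=\lceil\frac12\log_2 i\rceil$ and $u_i=u+n_{h(i)}+\log(i^a\zeta(a))$. At each round $i\ge1$ the algorithm queries a point $x_i$ and observes $y_i^j=g_j(x_i)+\epsilon_i^j$ for every $j\le N$, where the $\epsilon_i^j$ are i.i.d. $\mathcal N(0,\eta^2)$, independent of $(g_j)$. Let $\mu_{i-1}^j(x)$ and $\sigma_{i-1}(x)$ be the Gaussian posterior mean and standard deviation of $g_j(x)$ given $(y_l^j)_{l<i}$ (noise variance $\eta^2$), and $$U_i(x)=-\sum_{j\le N}\max\Big(0,\ |\mu_{i-1}^j(x)|-\sqrt{2(u_i+\log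 N)}\,\sigma_{i-1}(x)\Big)^2 .$$ Assume that $x_i$ is a function of the observations of rounds $1,\dots,i-1$ and $x_i\in\arg\max_{x\in\mathcal T_{h(i)}}U_i(x)$ for every $i\ge 1$. Let $R_t=t\max_{x} f(x)-\sum_{i\le t} f(x_i)$ and let $$\gamma_t=\max_{(x_1,\dots,x_t)\in\mathcal X^t}\tfrac12\log\det\big(I+\eta^{-2}[k(x_a,x_b)]_{a,b\le t}\big)$$ be the maximum information gain. Then, with probability at least $1-2e^{-u}$, simultaneously for all $t\ge1$, $$R_t\le C\Big(N\big(\sqrt{t\,\gamma_t\log t}+\gamma_t\big)+\sqrt{Nt}\,\log t\Big).$$ -/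

import Mathlib

open MeasureTheory ProbabilityTheory

noncomputable section

namespace SquaredGP

/-! ### The process -/

/-- `(g j)` are i.i.d. centered Gaussian processes with covariance function `k`. -/
structure IsIIDGaussianProcess {Ω X : Type*} [MeasurableSpace Ω] {N : ℕ} (P : Measure Ω)
    (g : Fin N → X → Ω → ℝ) (k : X → X → ℝ) : Prop where
  measurable : ∀ j x, Measurable (g j x)
  gaussian : ∀ j, IsGaussianProcess (g j) P
  mean_zero : ∀ j x, ∫ ω, g j x ω ∂P = 0
  covariance_eq : ∀ j x y, covariance (g j x) (g j y) P = k x y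
  indep : iIndepFun (fun j ω x => g j x ω) P

/-- The objective `f = - ∑ j, (g j) ^ 2`. -/
def objective {Ω X : Type*} {N : ℕ} (g : Fin N → X → Ω → ℝ) (x : X) (ω : Ω) : ℝ :=
  -∑ j, (g j x ω) ^ 2

/-- The pseudo-metric `d(x, y) = 2 √(κ² - k(x, y)²)`. -/
def dist {X : Type*} (κ : ℝ) (k : X → X → ℝ) (x y : X) : ℝ :=
  2 * Real.sqrt (κ ^ 2 - k x y ^ 2)

/-- `f` is a sub-Gamma process with parameters `ν`, `c` for the pseudo-metric `d`: the increments
of `f` satisfy `log E exp (l (f x - f y)) ≤ ν l² d(x,y)² / (2 (1 - c l d(x,y)))` for all `l ≥ 0`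
such that `c l d(x,y) < 1` (finiteness of the exponential moment included). -/
structure IsSubGammaProcess {Ω X : Type*} [MeasurableSpace Ω] (P : Measure Ω)
    (f : X → Ω → ℝ) (d : X → X → ℝ) (ν c : ℝ) : Prop where
  dist_self : ∀ x, d x x = 0
  dist_nonneg : ∀ x y, 0 ≤ d x y
  dist_comm : ∀ x y, d x y = d y x
  dist_triangle : ∀ x y z, d x z ≤ d x y + d y z
  integrable_exp : ∀ x y, ∀ l : ℝ, 0 ≤ l → c * l * d x y < 1 →
    Integrable (fun ω => Real.exp (l * (f x ω - f y ω))) P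
  cgf_le : ∀ x y, ∀ l : ℝ, 0 ≤ l → c * l * d x y < 1 →
    cgf (fun ω => f x ω - f y ω) P l ≤ ν * l ^ 2 * d x y ^ 2 / (2 * (1 - c * l * d x y))

/-! ### Discretization of the (finite) search space -/

section Tree

variable {X : Type*} [Fintype X]

/-- `T` is an `ε`-net: the closed `d`-balls of radius `ε` centered in `T` cover `X`. -/
def IsNet (d : X → X → ℝ) (ε : ℝ) (T : Finset X) : Prop :=
  ∀ x, ∃ s ∈ T, d x s ≤ ε

/-- The covering number `N(X, d, ε)`: the smallest cardinality of an `ε`-net. -/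
def coveringNumber (d : X → X → ℝ) (ε : ℝ) : ℕ :=
  sInf {n : ℕ | ∃ T : Finset X, IsNet d ε T ∧ T.card = n}

/-- The diameter `Δ` of `X`. -/
def diameter (d : X → X → ℝ) : ℝ := ⨆ p : X × X, d p.1 p.2

/-- The radius at depth `h`: `ε_h = Δ 2^{-h}`. -/
def radius (d : X → X → ℝ) (h : ℕ) : ℝ := diameter d / 2 ^ h

/-- `n_h = 2 log N(X, d, ε_h)`. -/
def levelExponent (d : X → X → ℝ) (h : ℕ) : ℝ :=
  2 * Real.log (coveringNumber d (radius d h))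

/-- A tree of successive discretizations of `X`: depth `h` is an `ε_h`-net with at most `e^{n_h}`
points (for instance a minimal one), and the parent of a node is a closest node in the level
above. -/
structure ChainingTree (d : X → X → ℝ) where
  level : ℕ → Finset X
  parent : ℕ → X → X
  isNet : ∀ h, IsNet d (radius d h) (level h)
  card_le : ∀ h, ((level h).card : ℝ) ≤ Real.exp (levelExponent d h)
  parent_mem : ∀ h, ∀ x ∈ level (h + 1), parent h x ∈ level h
  parent_closest : ∀ h, ∀ x ∈ level (h + 1), ∀ s ∈ level h, d x (parent h x) ≤ d x s

end Tree

/-! ### Gaussian posteriors and information gain -/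

section Posterior

variable {X : Type*}

/-- The covariance matrix of the points `xs`. -/
def covMatrix (k : X → X → ℝ) {m : ℕ} (xs : Fin m → X) : Matrix (Fin m) (Fin m) ℝ :=
  Matrix.of fun a b => k (xs a) (xs b)

/-- Posterior mean at `x` given noisy values `ys` (noise variance `η²`) at the points `xs`. -/
def posteriorMean (k : X → X → ℝ) (η : ℝ) {m : ℕ} (xs : Fin m → X) (ys : Fin m → ℝ) (x : X) : ℝ :=
  (fun a => k (xs a) x) ⬝ᵥ
    (Matrix.mulVec (covMatrix k xs + η ^ 2 • (1 : Matrix (Fin m) (Fin m) ℝ))⁻¹ ys)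

/-- Posterior standard deviation at `x` given noisy values at the points `xs`. -/
def posteriorSD (k : X → X → ℝ) (η : ℝ) {m : ℕ} (xs : Fin m → X) (x : X) : ℝ :=
  Real.sqrt (k x x - (fun a => k (xs a) x) ⬝ᵥ
    (Matrix.mulVec (covMatrix k xs + η ^ 2 • (1 : Matrix (Fin m) (Fin m) ℝ))⁻¹
      (fun a => k (xs a) x)))

/-- The maximum information gain of `t` noisy observations of a Gaussian process with covariance
`k`: `γ_t = max ½ log det (I + η⁻² K_t)` over `t` (not necessarily distinct) query points. -/
def maxInfoGain (k : X → X → ℝ) (η : ℝ) (t : ℕ) : ℝ :=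
  ⨆ xs : Fin t → X,
    (1 / 2) * Real.log (1 + (η ^ 2)⁻¹ • covMatrix k xs).det

end Posterior

/-! ### The algorithm

Rounds are numbered from `0`: `q m` is the query made in round `m + 1`, after `m` observations. -/

/-- The observation noise: i.i.d. `N(0, η²)` variables, independent of the processes `g j`. -/
structure IsNoise {Ω X : Type*} [MeasurableSpace Ω] {N : ℕ} (P : Measure Ω)
    (noise : ℕ → Fin N → Ω → ℝ) (η : ℝ) (g : Fin N → X → Ω → ℝ) : Prop where
  measurable : ∀ m j, Measurable (noise m j)
  law : ∀ m j, P.map (noise m j) = gaussianReal 0 (Real.toNNReal (η ^ 2))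
  indep : iIndepFun (fun (p : ℕ × Fin N) => noise p.1 p.2) P
  indep_process : IndepFun (fun ω (p : Fin N × X) => g p.1 p.2 ω)
    (fun ω (p : ℕ × Fin N) => noise p.1 p.2 ω) P

section Algorithm

variable {Ω X : Type*} {N : ℕ}

/-- The separated noisy observations: `y_m^j = g_j(q_m) + noise`. -/
def observation (g : Fin N → X → Ω → ℝ) (noise : ℕ → Fin N → Ω → ℝ) (q : ℕ → Ω → X)
    (m : ℕ) (j : Fin N) (ω : Ω) : ℝ :=
  g j (q m ω) ω + noise m j ω

/-- The information contained in the first `m` (vectors of) observations. -/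
@[reducible] def history (obs : ℕ → Fin N → Ω → ℝ) (m : ℕ) : MeasurableSpace Ω :=
  ⨆ l : Fin m, ⨆ j : Fin N, MeasurableSpace.comap (obs l j) inferInstance

/-- Half-width factor `√(2 (v + log N))` of the confidence intervals. -/
def confidenceFactor (N : ℕ) (v : ℝ) : ℝ := Real.sqrt (2 * (v + Real.log N))

/-- Upper confidence bound for `f(x) = -∑ j, g_j(x)²` after `m` observations:
minus the sum of the lower confidence bounds
`max(0, |μ^j(x)| - √(2 (v + log N)) σ(x))²` of the `g_j(x)²`. -/
def upperBound (k : X → X → ℝ) (η : ℝ) (obs : ℕ → Fin N → Ω → ℝ) (q : ℕ → Ω → X)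
    (m : ℕ) (v : ℝ) (x : X) (ω : Ω) : ℝ :=
  -∑ j : Fin N,
    (max 0 (|posteriorMean k η (fun l : Fin m => q l ω) (fun l : Fin m => obs l j ω) x|
      - confidenceFactor N v * posteriorSD k η (fun l : Fin m => q l ω) x)) ^ 2

/-- The discretization depth `h(i) = ⌈½ log₂ i⌉`. -/
def depth (i : ℕ) : ℕ := ⌈(1 / 2) * Real.logb 2 i⌉₊

variable [Fintype X]

/-- The confidence level `u_i = u + n_{h(i)} + log (i^a ζ(a))` of round `i ≥ 1`. -/
def confidenceLevel (d : X → X → ℝ) (u a : ℝ) (i : ℕ) : ℝ :=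
  u + levelExponent d (depth i) + Real.log ((i : ℝ) ^ a * (riemannZeta (a : ℂ)).re)

/-- The queries `q` are those of the optimistic algorithm: each query is a function of the past
observations, and it maximizes the current upper confidence bound over the level `h(i)` of the
tree. -/
structure IsOptimistic (k : X → X → ℝ) (d : X → X → ℝ) (η u a : ℝ) (T : ChainingTree d)
    (obs : ℕ → Fin N → Ω → ℝ) (q : ℕ → Ω → X) : Prop where
  adapted : ∀ m x, MeasurableSet[history obs m] {ω | q m ω = x}
  mem_level : ∀ m ω, q m ω ∈ T.level (depth (m + 1))
  maximizes : ∀ m ω, ∀ x ∈ T.level (depth (m + 1)),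
    upperBound k η obs q m (confidenceLevel d u a (m + 1)) x ω ≤
      upperBound k η obs q m (confidenceLevel d u a (m + 1)) (q m ω) ω

end Algorithm

/-- The cumulative regret `R_t = t sup f - ∑_{i ≤ t} f(x_i)`. -/
def regret {Ω X : Type*} (f : X → Ω → ℝ) (q : ℕ → Ω → X) (t : ℕ) (ω : Ω) : ℝ :=
  t * (⨆ x, f x ω) - ∑ m ∈ Finset.range t, f (q m ω) ω

end SquaredGP

end

noncomputable section

namespace SquaredGP

/-! ### Products of independent centered Gaussian variables -/

/-! Sub-Gamma part. Each coordinate contributes `(g_j(y) - g_j(x)) (g_j(y) + g_j(x))` to `f(x) -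
f(y)`. Since the variance is constant, difference and sum are uncorrelated, hence independent, with
variances `2(κ - k)` and `2(κ + k)`, whose product is `d²`. A product of independent centered
Gaussians with variances `v`, `w` has moment generating function `(1 - l²vw)^(-1/2)`, so the
log-moment is exactly `-(N/2) log(1 - l²d²)`, and `log w ≥ 1 - 1/w` gives the claim.

Regret part. Two events, each failing with probability at most `e^{-u}`, imply the bound
deterministically. `measure_not_confidenceHolds_le`: along a fixed query path the posterior residual
is independent of the observations. The event that the algorithm follows that path depends only on
these observations, so the Gaussian tail survives adaptivity; a union bound over rounds, nodes and
coordinates follows. `measure_not_chainingHolds_le`: sub-Gamma tails hold along all tree edges, and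
`-f` at the root is `O(N)` by Markov. Summing edges, every `f(x)` is within `c (2h+4)/2^h` of a
value at level `h`, with `c` of order `√N Δ (1 + log⁺(R/Δ))`.

On these events optimism gives an instantaneous regret of at most the discretization error plus `4 β
σ ∑_j |g_j(q)|`, where `q` is the query, and `∑_j |g_j| ≤ √N √(-f) = O(N)`. Discretization errors
add up to `√(Nt) log t`; Cauchy-Schwarz and `sum_posteriorVar_le` bound the sum of the `σ` by `√(t
γ_t)`.

For a constant free of `N`, `X` and `Δ`, two regimes use the crude bound `t · sup(f(x) - f(y))`
instead: `t ≤ N`, where the `log N` inside `β` exceeds `log t`, and `Δ ≤ 1/t`, where `log(R/Δ)` is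
uncontrolled. `regret_le_of_good` assembles the cases. -/

lemma integrable_exp_mul_sq_gaussianReal {v : NNReal} {c : ℝ} (h : 2 * c * v < 1) :
    Integrable (fun x => Real.exp (c * x ^ 2)) (gaussianReal 0 v) := by
  by_cases hv : v = 0
  · subst hv
    simp only [gaussianReal_zero_var]
    exact integrable_dirac (by simp)
  · have hv' : (0 : ℝ) < v := by positivity
    rw [gaussianReal_of_var_ne_zero _ hv, integrable_withDensity_iff_integrable_smul'
      (measurable_gaussianPDF 0 v) (Filter.Eventually.of_forall fun x => gaussianPDF_lt_top)]
    have hb : 0 < 1 / (2 * (v : ℝ)) - c := by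
      rw [sub_pos, lt_div_iff₀ (by positivity)]; linarith
    refine ((integrable_exp_neg_mul_sq hb).const_mul (√(2 * Real.pi * v))⁻¹).congr
      (Filter.Eventually.of_forall fun x => ?_)
    simp only [toReal_gaussianPDF, gaussianPDFReal_def, smul_eq_mul]
    rw [mul_assoc (√(2 * Real.pi * v))⁻¹, ← Real.exp_add]
    congr 2
    field_simp
    ring

lemma integral_exp_mul_sq_gaussianReal {v : NNReal} {c : ℝ} (h : 2 * c * v < 1) :
    ∫ x, Real.exp (c * x ^ 2) ∂gaussianReal 0 v = (√(1 - 2 * c * v))⁻¹ := by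
  by_cases hv : v = 0
  · subst hv
    simp [gaussianReal_zero_var]
  · have hv' : (0 : ℝ) < v := by positivity
    have hb : 0 < 1 / (2 * (v : ℝ)) - c := by
      rw [sub_pos, lt_div_iff₀ (by positivity)]; linarith
    rw [integral_gaussianReal_eq_integral_smul hv]
    have : ∀ x, gaussianPDFReal 0 v x • Real.exp (c * x ^ 2) =
        (√(2 * Real.pi * v))⁻¹ * Real.exp (-(1 / (2 * (v : ℝ)) - c) * x ^ 2) := by
      intro x
      simp only [gaussianPDFReal_def, smul_eq_mul]
      rw [mul_assoc, ← Real.exp_add]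
      congr 2
      field_simp
      ring
    simp_rw [this]
    rw [integral_const_mul, integral_gaussian, ← Real.sqrt_inv, ← Real.sqrt_mul (by positivity),
      ← Real.sqrt_inv]
    congr 1
    have : 1 - 2 * c * v ≠ 0 := by linarith
    have h2 : 1 / (2 * (v : ℝ)) - c = (1 - 2 * c * v) / (2 * v) := by field_simp
    rw [h2]
    have := Real.pi_ne_zero
    field_simp

lemma integrable_exp_mul_mul_prod_gaussianReal {v w : NNReal} {l : ℝ} (h : l ^ 2 * (v * w) < 1) :
    Integrable (fun p : ℝ × ℝ => Real.exp (l * (p.1 * p.2)))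
      ((gaussianReal 0 v).prod (gaussianReal 0 w)) := by
  rw [integrable_prod_iff' (by fun_prop)]
  refine ⟨Filter.Eventually.of_forall fun y => ?_, ?_⟩
  · refine (integrable_exp_mul_gaussianReal (μ := 0) (v := v) (l * y)).congr
      (Filter.Eventually.of_forall fun x => ?_)
    simp only
    ring_nf
  · refine (integrable_exp_mul_sq_gaussianReal (v := w) (c := l ^ 2 * v / 2)
      (by linarith)).congr (Filter.Eventually.of_forall fun y => ?_)
    have := congrFun (mgf_fun_id_gaussianReal (μ := 0) (v := v)) (l * y)
    simp only [mgf] at this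
    simp only [Real.norm_eq_abs, Real.abs_exp]
    calc _ = Real.exp (0 * (l * y) + v * (l * y) ^ 2 / 2) := by ring_nf
      _ = _ := by rw [← this]; congr 1; ext x; ring_nf

/-- Integrating out the first factor with the Gaussian moment generating function leaves the
exponential of a multiple of a squared Gaussian. -/
lemma integral_exp_mul_mul_prod_gaussianReal {v w : NNReal} {l : ℝ} (h : l ^ 2 * (v * w) < 1) :
    ∫ p : ℝ × ℝ, Real.exp (l * (p.1 * p.2)) ∂((gaussianReal 0 v).prod (gaussianReal 0 w)) =
      (√(1 - l ^ 2 * (v * w)))⁻¹ := by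
  rw [integral_prod_symm _ (integrable_exp_mul_mul_prod_gaussianReal h)]
  have hi : ∀ y : ℝ, ∫ x, Real.exp (l * (x * y)) ∂gaussianReal 0 v =
      Real.exp ((l ^ 2 * v / 2) * y ^ 2) := by
    intro y
    have := congrFun (mgf_fun_id_gaussianReal (μ := 0) (v := v)) (l * y)
    simp only [mgf] at this
    calc _ = ∫ x, Real.exp (l * y * x) ∂gaussianReal 0 v := by congr 1; ext x; ring_nf
      _ = _ := by rw [this]; ring_nf
  simp_rw [hi]
  rw [integral_exp_mul_sq_gaussianReal (by linarith)]
  ring_nf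

section Moments

variable {Ω : Type*} [MeasurableSpace Ω] {P : Measure Ω} [IsProbabilityMeasure P]

lemma map_prod_eq_of_gaussian_indep {A B : Ω → ℝ} (hAm : AEMeasurable A P) (hBm : AEMeasurable B P)
    {v w : NNReal} (hA : P.map A = gaussianReal 0 v) (hB : P.map B = gaussianReal 0 w)
    (hAB : IndepFun A B P) :
    P.map (fun ω => (A ω, B ω)) = (gaussianReal 0 v).prod (gaussianReal 0 w) := by
  rw [(indepFun_iff_map_prod_eq_prod_map_map hAm hBm).1 hAB, hA, hB]

lemma integrable_exp_mul_mul_of_gaussian_indep {A B : Ω → ℝ} (hAm : AEMeasurable A P)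
    (hBm : AEMeasurable B P) {v w : NNReal} (hA : P.map A = gaussianReal 0 v)
    (hB : P.map B = gaussianReal 0 w) (hAB : IndepFun A B P) {l : ℝ} (h : l ^ 2 * (v * w) < 1) :
    Integrable (fun ω => Real.exp (l * (A ω * B ω))) P := by
  have := integrable_exp_mul_mul_prod_gaussianReal h
  rw [← map_prod_eq_of_gaussian_indep hAm hBm hA hB hAB,
    integrable_map_measure (by fun_prop) (by fun_prop)] at this
  exact this

lemma mgf_mul_of_gaussian_indep {A B : Ω → ℝ} (hAm : AEMeasurable A P)
    (hBm : AEMeasurable B P) {v w : NNReal} (hA : P.map A = gaussianReal 0 v)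
    (hB : P.map B = gaussianReal 0 w) (hAB : IndepFun A B P) {l : ℝ} (h : l ^ 2 * (v * w) < 1) :
    mgf (fun ω => A ω * B ω) P l = (√(1 - l ^ 2 * (v * w)))⁻¹ := by
  rw [← integral_exp_mul_mul_prod_gaussianReal h,
    ← map_prod_eq_of_gaussian_indep hAm hBm hA hB hAB,
    integral_map (by fun_prop) (by fun_prop)]
  rfl

/-- Cauchy-Schwarz, from the discriminant of the nonnegative quadratic `t ↦ Var(tU + V)`. -/
lemma covariance_sq_le_variance_mul {U V : Ω → ℝ} (hU : MemLp U 2 P) (hV : MemLp V 2 P) :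
    covariance U V P ^ 2 ≤ variance U P * variance V P := by
  have key : ∀ t : ℝ, 0 ≤ variance U P * (t * t) + (2 * covariance U V P) * t + variance V P := by
    intro t
    have := variance_nonneg (t • U + V) P
    rw [variance_add (hU.const_smul t) hV, variance_smul, covariance_smul_left] at this
    linarith
  have := discrim_le_zero key
  rw [discrim] at this
  linarith

end Moments

/-! ### Increments of the objective -/

/-- With `a = κ cos α` and `b = κ cos β`, this is the subadditivity of the sine; the hypothesis is
the nonnegativity of a 3 × 3 Gram determinant. -/
lemma sqrt_sub_sq_triangle {κ a b c : ℝ} (hκ : 0 < κ) (ha : a ^ 2 ≤ κ ^ 2) (hb : b ^ 2 ≤ κ ^ 2)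
    (h : (κ * c - a * b) ^ 2 ≤ (κ ^ 2 - a ^ 2) * (κ ^ 2 - b ^ 2)) :
    √(κ ^ 2 - c ^ 2) ≤ √(κ ^ 2 - a ^ 2) + √(κ ^ 2 - b ^ 2) := by
  obtain ⟨A, hA⟩ : ∃ A, A = √(κ ^ 2 - a ^ 2) := ⟨_, rfl⟩
  obtain ⟨B, hB⟩ : ∃ B, B = √(κ ^ 2 - b ^ 2) := ⟨_, rfl⟩
  have hA0 : 0 ≤ A := hA ▸ Real.sqrt_nonneg _
  have hB0 : 0 ≤ B := hB ▸ Real.sqrt_nonneg _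
  have hA2 : A ^ 2 = κ ^ 2 - a ^ 2 := by rw [hA, Real.sq_sqrt (by linarith)]
  have hB2 : B ^ 2 = κ ^ 2 - b ^ 2 := by rw [hB, Real.sq_sqrt (by linarith)]
  rw [← hA, ← hB]
  refine Real.sqrt_le_iff.2 ⟨by positivity, ?_⟩
  rw [← hA2, ← hB2, ← mul_pow] at h
  have h1 : |κ * c - a * b| ≤ A * B := abs_le_of_sq_le_sq h (by positivity)
  have hAB0 : 0 ≤ A * B := by positivity
  have habs : |a * b| ≤ κ ^ 2 := by
    refine abs_le_of_sq_le_sq ?_ (by positivity)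
    rw [mul_pow]
    calc a ^ 2 * b ^ 2 ≤ κ ^ 2 * κ ^ 2 := by gcongr
      _ = _ := by ring
  have hsq : |a * b| ^ 2 = κ ^ 4 - κ ^ 2 * (A ^ 2 + B ^ 2) + (A * B) ^ 2 := by
    rw [sq_abs, mul_pow, mul_pow, hA2, hB2]; ring
  have hκ2 : 0 < κ ^ 2 := by positivity
  -- If `AB ≤ |ab|`, then `|κc| ≥ |ab| - AB` bounds `c²` from below. Otherwise `κ² ≤ A² + B²`, and
  -- dropping `c²` is enough.
  rcases le_total (A * B) |a * b| with hle | hle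
  · have h2 : |a * b| - A * B ≤ |κ * c| := by
      have := abs_sub_abs_le_abs_sub (a * b) (κ * c)
      rw [abs_sub_comm] at this
      linarith
    have h3 : (|a * b| - A * B) ^ 2 ≤ κ ^ 2 * c ^ 2 := by
      rw [← mul_pow, ← sq_abs (κ * c)]
      exact pow_le_pow_left₀ (by linarith) h2 2
    have h4 : |a * b| * (A * B) ≤ κ ^ 2 * (A * B) := by gcongr
    have h5 : κ ^ 2 * (κ ^ 2 - c ^ 2) ≤ κ ^ 2 * (A + B) ^ 2 := by nlinarith [sq_nonneg (A * B)]
    exact le_of_mul_le_mul_left h5 hκ2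
  · have h3 : |a * b| ^ 2 ≤ (A * B) ^ 2 := pow_le_pow_left₀ (abs_nonneg _) hle 2
    have h5 : κ ^ 2 * κ ^ 2 ≤ κ ^ 2 * (A ^ 2 + B ^ 2) := by nlinarith
    have := le_of_mul_le_mul_left h5 hκ2
    nlinarith [sq_nonneg c]

namespace IsIIDGaussianProcess

variable {Ω X : Type*} [MeasurableSpace Ω] {P : Measure Ω} {N : ℕ} {κ : ℝ} {k : X → X → ℝ}
  {g : Fin N → X → Ω → ℝ}

lemma memLp (hg : IsIIDGaussianProcess P g k) (j : Fin N) (x : X) : MemLp (g j x) 2 P :=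
  ((hg.gaussian j).hasGaussianLaw_eval x).memLp_two

lemma kernel_comm (hg : IsIIDGaussianProcess P g k) (j : Fin N) (x y : X) : k x y = k y x := by
  rw [← hg.covariance_eq j, ← hg.covariance_eq j, covariance_comm]

lemma variance_eq (hg : IsIIDGaussianProcess P g k) (hk : ∀ x, k x x = κ) (j : Fin N) (x : X) :
    variance (g j x) P = κ := by
  rw [← covariance_self (hg.measurable j x).aemeasurable, hg.covariance_eq, hk]

variable [IsProbabilityMeasure P]

lemma kernel_sq_le (hg : IsIIDGaussianProcess P g k) (hk : ∀ x, k x x = κ) (j : Fin N) (x y : X) :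
    k x y ^ 2 ≤ κ ^ 2 := by
  have := covariance_sq_le_variance_mul (hg.memLp j x) (hg.memLp j y)
  rw [hg.covariance_eq, hg.variance_eq hk, hg.variance_eq hk] at this
  linarith

omit [IsProbabilityMeasure P] in
lemma kernel_self_nonneg (hg : IsIIDGaussianProcess P g k) (hk : ∀ x, k x x = κ) (j : Fin N)
    (x : X) : 0 ≤ κ :=
  hg.variance_eq hk j x ▸ variance_nonneg _ _

/-- Cauchy-Schwarz for `g(x)` and `g(z)` after regressing out `g(y)`; scaling by `κ` avoids
divisions and leaves a factor `κ²` to cancel. -/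
lemma kernel_triple (hg : IsIIDGaussianProcess P g k) (hk : ∀ x, k x x = κ) (j : Fin N)
    (hκ : 0 < κ) (x y z : X) :
    (κ * k x z - k x y * k y z) ^ 2 ≤ (κ ^ 2 - k x y ^ 2) * (κ ^ 2 - k y z ^ 2) := by
  have hx := hg.memLp j x
  have hy := hg.memLp j y
  have hz := hg.memLp j z
  have hU : MemLp (κ • g j x - k x y • g j y) 2 P := (hx.const_smul _).sub (hy.const_smul _)
  have hV : MemLp (κ • g j z - k y z • g j y) 2 P := (hz.const_smul _).sub (hy.const_smul _)
  have := covariance_sq_le_variance_mul hU hV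
  rw [covariance_sub_sub (hx.const_smul _) (hy.const_smul _) (hz.const_smul _) (hy.const_smul _),
    variance_sub (hx.const_smul _) (hy.const_smul _),
    variance_sub (hz.const_smul _) (hy.const_smul _)] at this
  simp only [covariance_smul_left, covariance_smul_right, variance_smul, hg.covariance_eq,
    hg.variance_eq hk, hk, hg.kernel_comm j z y] at this
  have h2 : κ ^ 2 * (κ * k x z - k x y * k y z) ^ 2 ≤
      κ ^ 2 * ((κ ^ 2 - k x y ^ 2) * (κ ^ 2 - k y z ^ 2)) := by nlinarith
  exact le_of_mul_le_mul_left h2 (by positivity)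

lemma sq_dist (hg : IsIIDGaussianProcess P g k) (hk : ∀ x, k x x = κ) (j : Fin N) (x y : X) :
    dist κ k x y ^ 2 = 4 * (κ ^ 2 - k x y ^ 2) := by
  rw [dist, mul_pow, Real.sq_sqrt (sub_nonneg.2 (hg.kernel_sq_le hk j x y))]
  norm_num

lemma dist_triangle (hg : IsIIDGaussianProcess P g k) (hk : ∀ x, k x x = κ) (j : Fin N)
    (x y z : X) : dist κ k x z ≤ dist κ k x y + dist κ k y z := by
  rcases (hg.kernel_self_nonneg hk j x).eq_or_lt with h | h
  · subst h
    have : ∀ a b, dist 0 k a b = 0 := by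
      intro a b
      rw [dist, Real.sqrt_eq_zero_of_nonpos, mul_zero]
      nlinarith [sq_nonneg (k a b)]
    simp [this]
  · have := sqrt_sub_sq_triangle h (hg.kernel_sq_le hk j x y) (hg.kernel_sq_le hk j y z)
      (hg.kernel_triple hk j h x y z)
    simp only [dist]
    linarith

omit [IsProbabilityMeasure P] in
lemma map_eq_gaussianReal_of_integral_eq_zero {A : Ω → ℝ} (hA : HasGaussianLaw A P)
    (h : ∫ ω, A ω ∂P = 0) : P.map A = gaussianReal 0 (variance A P).toNNReal := by
  rw [hA.map_eq_gaussianReal, h]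

section Increment

variable (hg : IsIIDGaussianProcess P g k) (hk : ∀ x, k x x = κ) (j : Fin N) (x y : X)

include hg hk

/-- The covariance is `k(y,y) - k(x,x) = 0`, and joint Gaussianity turns this into independence. -/
lemma indepFun_sub_add : IndepFun (g j y - g j x) (g j y + g j x) P := by
  have hx := hg.memLp j x
  have hy := hg.memLp j y
  refine HasGaussianLaw.indepFun_of_covariance_eq_zero ?_ ?_
  · have := (hg.gaussian j).hasGaussianLaw_prodMk (s := x) (t := y)
    exact this.map_fun (((ContinuousLinearMap.snd ℝ ℝ ℝ) - (ContinuousLinearMap.fst ℝ ℝ ℝ)).prod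
      ((ContinuousLinearMap.snd ℝ ℝ ℝ) + (ContinuousLinearMap.fst ℝ ℝ ℝ)))
  · rw [covariance_sub_left hy hx (hy.add hx), covariance_add_right hy hy hx,
      covariance_add_right hx hy hx]
    simp only [hg.covariance_eq, hk, hg.kernel_comm j y x]
    ring

lemma map_sub_eq :
    P.map (g j y - g j x) = gaussianReal 0 (2 * (κ - k x y)).toNNReal := by
  have hx := hg.memLp j x
  have hy := hg.memLp j y
  rw [map_eq_gaussianReal_of_integral_eq_zero (hg.gaussian j).hasGaussianLaw_sub,
    variance_sub hy hx, hg.variance_eq hk, hg.variance_eq hk, hg.covariance_eq,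
    hg.kernel_comm j y x]
  · ring_nf
  · simp only [Pi.sub_apply]
    rw [integral_sub (hy.integrable one_le_two) (hx.integrable one_le_two), hg.mean_zero,
      hg.mean_zero, sub_zero]

lemma map_add_eq :
    P.map (g j y + g j x) = gaussianReal 0 (2 * (κ + k x y)).toNNReal := by
  have hx := hg.memLp j x
  have hy := hg.memLp j y
  rw [map_eq_gaussianReal_of_integral_eq_zero (hg.gaussian j).hasGaussianLaw_add,
    variance_add hy hx, hg.variance_eq hk, hg.variance_eq hk, hg.covariance_eq,
    hg.kernel_comm j y x]
  · ring_nf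
  · simp only [Pi.add_apply]
    rw [integral_add (hy.integrable one_le_two) (hx.integrable one_le_two), hg.mean_zero,
      hg.mean_zero, add_zero]

lemma toNNReal_mul_toNNReal_eq (j : Fin N) (x y : X) :
    (((2 * (κ - k x y)).toNNReal : ℝ) * ((2 * (κ + k x y)).toNNReal : ℝ)) =
      dist κ k x y ^ 2 := by
  have h := abs_le_of_sq_le_sq (hg.kernel_sq_le hk j x y) (hg.kernel_self_nonneg hk j x)
  rw [abs_le] at h
  rw [Real.coe_toNNReal _ (by linarith), Real.coe_toNNReal _ (by linarith), hg.sq_dist hk j]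
  ring

lemma integrable_exp_increment {l : ℝ} (hl : l ^ 2 * dist κ k x y ^ 2 < 1) :
    Integrable (fun ω => Real.exp (l * ((g j y ω - g j x ω) * (g j y ω + g j x ω)))) P := by
  rw [← hg.toNNReal_mul_toNNReal_eq hk j] at hl
  have hx := (hg.measurable j x)
  have hy := (hg.measurable j y)
  exact integrable_exp_mul_mul_of_gaussian_indep (hy.sub hx).aemeasurable (hy.add hx).aemeasurable
    (hg.map_sub_eq hk j x y) (hg.map_add_eq hk j x y) (hg.indepFun_sub_add hk j x y) hl

lemma mgf_increment {l : ℝ} (hl : l ^ 2 * dist κ k x y ^ 2 < 1) :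
    mgf (fun ω => (g j y ω - g j x ω) * (g j y ω + g j x ω)) P l =
      (√(1 - l ^ 2 * dist κ k x y ^ 2))⁻¹ := by
  rw [← hg.toNNReal_mul_toNNReal_eq hk j] at hl ⊢
  have hx := (hg.measurable j x)
  have hy := (hg.measurable j y)
  exact mgf_mul_of_gaussian_indep (hy.sub hx).aemeasurable (hy.add hx).aemeasurable
    (hg.map_sub_eq hk j x y) (hg.map_add_eq hk j x y) (hg.indepFun_sub_add hk j x y) hl

omit hk [IsProbabilityMeasure P] in
lemma iIndepFun_increment :
    iIndepFun (fun j ω => (g j y ω - g j x ω) * (g j y ω + g j x ω)) P :=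
  hg.indep.comp (fun _ (v : X → ℝ) => (v y - v x) * (v y + v x)) (fun _ => by fun_prop)

end Increment

omit [MeasurableSpace Ω] in
lemma objective_sub_eq (x y : X) :
    (fun ω => objective g x ω - objective g y ω) =
      ∑ j, fun ω => (g j y ω - g j x ω) * (g j y ω + g j x ω) := by
  ext ω
  simp only [objective, Finset.sum_apply]
  rw [neg_sub_neg, ← Finset.sum_sub_distrib]
  exact Finset.sum_congr rfl fun j _ => by ring

lemma integrable_exp_objective_sub (hg : IsIIDGaussianProcess P g k) (hk : ∀ x, k x x = κ)
    (x y : X) {l : ℝ} (hl : l ^ 2 * dist κ k x y ^ 2 < 1) :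
    Integrable (fun ω => Real.exp (l * (objective g x ω - objective g y ω))) P := by
  have := (hg.iIndepFun_increment x y).integrable_exp_mul_sum (t := l) (s := Finset.univ)
    (fun j => ((hg.measurable j y).sub (hg.measurable j x)).mul
      ((hg.measurable j y).add (hg.measurable j x)))
    (fun j _ => hg.integrable_exp_increment hk j x y hl)
  rw [← objective_sub_eq x y] at this
  exact this

lemma cgf_objective_sub (hg : IsIIDGaussianProcess P g k) (hk : ∀ x, k x x = κ)
    (x y : X) {l : ℝ} (hl : l ^ 2 * dist κ k x y ^ 2 < 1) :
    cgf (fun ω => objective g x ω - objective g y ω) P l =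
      N * (-(1 / 2) * Real.log (1 - l ^ 2 * dist κ k x y ^ 2)) := by
  rw [objective_sub_eq x y, (hg.iIndepFun_increment x y).cgf_sum
    (fun j => ((hg.measurable j y).sub (hg.measurable j x)).mul
      ((hg.measurable j y).add (hg.measurable j x)))
    (fun j _ => hg.integrable_exp_increment hk j x y hl)]
  simp only [cgf, hg.mgf_increment hk _ x y hl, Real.log_inv, Finset.sum_const,
    Finset.card_univ, Fintype.card_fin, nsmul_eq_mul]
  rw [Real.log_sqrt (by linarith)]
  ring

theorem isSubGammaProcess (hg : IsIIDGaussianProcess P g k) (hk : ∀ x, k x x = κ) (hN : 1 ≤ N) :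
    IsSubGammaProcess P (objective g) (dist κ k) N 1 where
  dist_self x := by simp [dist, hk]
  dist_nonneg x y := by simp only [dist]; positivity
  dist_comm x y := by simp only [dist, hg.kernel_comm ⟨0, hN⟩ x y]
  dist_triangle := hg.dist_triangle hk ⟨0, hN⟩
  integrable_exp x y l hl h := by
    refine hg.integrable_exp_objective_sub hk x y ?_
    have hd : 0 ≤ dist κ k x y := by simp only [dist]; positivity
    rw [← mul_pow]
    exact pow_lt_one₀ (by positivity) (by linarith) two_ne_zero
  cgf_le x y l hl h := by
    have hd : 0 ≤ dist κ k x y := by simp only [dist]; positivity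
    have hz : l ^ 2 * dist κ k x y ^ 2 < 1 := by
      rw [← mul_pow]
      exact pow_lt_one₀ (by positivity) (by linarith) two_ne_zero
    rw [hg.cgf_objective_sub hk x y hz]
    obtain ⟨z, hz'⟩ : ∃ z, z = l * dist κ k x y := ⟨_, rfl⟩
    have hz0 : 0 ≤ z := hz' ▸ by positivity
    have hz1 : z < 1 := by rw [hz']; linarith
    have e1 : l ^ 2 * dist κ k x y ^ 2 = z ^ 2 := by rw [hz']; ring
    have e2 : (N : ℝ) * l ^ 2 * dist κ k x y ^ 2 / (2 * (1 - 1 * l * dist κ k x y)) =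
        N * (1 / 2 * (z ^ 2 / (1 - z))) := by
      rw [mul_assoc (N : ℝ), e1, one_mul, ← hz']
      field_simp
    rw [e1] at hz
    rw [e1, e2]
    refine mul_le_mul_of_nonneg_left ?_ (Nat.cast_nonneg N)
    -- The exact log-moment is at most `(N/2) z²/(1 - z²)`; weakening `1 - z²` to `1 - z` gives the
    -- sub-Gamma form with `c = 1`.
    have hlog := Real.one_sub_inv_le_log_of_pos (x := 1 - z ^ 2) (by linarith)
    have h3 : 1 - (1 - z ^ 2)⁻¹ = - (z ^ 2 / (1 - z ^ 2)) := by
      have : 1 - z ^ 2 ≠ 0 := by linarith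
      field_simp
      ring
    have h4 : z ^ 2 / (1 - z ^ 2) ≤ z ^ 2 / (1 - z) := by
      gcongr
      nlinarith
    linarith

end IsIIDGaussianProcess

/-! ### A sharp Gaussian tail bound -/

/-- `(z + s)² ≥ z² + s²` when `s` and `z` have the same sign. -/
lemma gaussianPDF_add_le {s z : ℝ} (h : 0 ≤ s * z) :
    gaussianPDF 0 1 (z + s) ≤ ENNReal.ofReal (Real.exp (-s ^ 2 / 2)) * gaussianPDF 0 1 z := by
  rw [gaussianPDF_def, ← ENNReal.ofReal_mul (by positivity)]
  refine ENNReal.ofReal_le_ofReal ?_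
  simp only [gaussianPDFReal_def, NNReal.coe_one, sub_zero, mul_one]
  rw [mul_left_comm, ← Real.exp_add]
  gcongr
  linarith

lemma gaussianReal_preimage_sub_le {s : ℝ} {A : Set ℝ} (hA : MeasurableSet A)
    (h : ∀ z ∈ A, 0 ≤ s * z) :
    gaussianReal 0 1 {x | x - s ∈ A} ≤
      ENNReal.ofReal (Real.exp (-s ^ 2 / 2)) * gaussianReal 0 1 A := by
  have hA' : MeasurableSet {x | x - s ∈ A} := (measurable_sub_const s) hA
  rw [gaussianReal_apply _ one_ne_zero, gaussianReal_apply _ one_ne_zero,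
    ← lintegral_indicator hA', ← lintegral_add_right_eq_self _ s, ← lintegral_const_mul _
      (measurable_gaussianPDF 0 1), ← lintegral_indicator hA]
  refine lintegral_mono fun z => ?_
  by_cases hz : z ∈ A
  · rw [Set.indicator_of_mem (by simpa using hz), Set.indicator_of_mem hz]
    exact gaussianPDF_add_le (h z hz)
  · rw [Set.indicator_of_notMem (by simpa using hz)]
    exact zero_le

/-- There is no factor 2: each tail is a translated half-line, translation costs `e^{-s²/2}`, and
the two half-lines have total mass at most 1. This is what lets the confidence events fail with
probability at most `e^{-u}` exactly. -/
lemma gaussianReal_abs_gt_le {s : ℝ} (hs : 0 ≤ s) :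
    gaussianReal 0 1 {x | s < |x|} ≤ ENNReal.ofReal (Real.exp (-s ^ 2 / 2)) := by
  have hsub : {x : ℝ | s < |x|} ⊆ {x | x - s ∈ Set.Ioi 0} ∪ {x | x - (-s) ∈ Set.Iio 0} := by
    intro x hx
    simp only [Set.mem_ofPred_eq, lt_abs, Set.mem_union, Set.mem_Ioi, Set.mem_Iio] at hx ⊢
    rcases hx with hx | hx
    · left; linarith
    · right; linarith
  calc gaussianReal 0 1 {x | s < |x|}
      ≤ gaussianReal 0 1 {x | x - s ∈ Set.Ioi 0} + gaussianReal 0 1 {x | x - (-s) ∈ Set.Iio 0} :=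
        (measure_mono hsub).trans (measure_union_le _ _)
    _ ≤ ENNReal.ofReal (Real.exp (-s ^ 2 / 2)) * gaussianReal 0 1 (Set.Ioi 0) +
        ENNReal.ofReal (Real.exp (-(-s) ^ 2 / 2)) * gaussianReal 0 1 (Set.Iio 0) := by
        refine add_le_add
          (gaussianReal_preimage_sub_le measurableSet_Ioi fun z hz => ?_)
          (gaussianReal_preimage_sub_le measurableSet_Iio fun z hz => ?_)
        · exact mul_nonneg hs (le_of_lt hz)
        · exact mul_nonneg_of_nonpos_of_nonpos (by linarith) (le_of_lt hz)
    _ = ENNReal.ofReal (Real.exp (-s ^ 2 / 2)) *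
        (gaussianReal 0 1 (Set.Ioi 0 ∪ Set.Iio 0)) := by
        rw [neg_sq, ← mul_add, measure_union _ measurableSet_Iio]
        rw [Set.disjoint_left]
        intro x hx hx'
        simp only [Set.mem_Ioi, Set.mem_Iio] at hx hx'
        linarith
    _ ≤ ENNReal.ofReal (Real.exp (-s ^ 2 / 2)) * 1 := by gcongr; exact prob_le_one
    _ = _ := mul_one _

lemma measure_abs_gt_le_of_map_eq_gaussianReal {Ω : Type*} [MeasurableSpace Ω] {P : Measure Ω}
    {r : Ω → ℝ} (hr : AEMeasurable r P) {v : ℝ} (hv : 0 ≤ v)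
    (h : P.map r = gaussianReal 0 v.toNNReal) {s : ℝ} (hs : 0 ≤ s) :
    P {ω | s * √v < |r ω|} ≤ ENNReal.ofReal (Real.exp (-s ^ 2 / 2)) := by
  have hmeas : MeasurableSet {x : ℝ | s * √v < |x|} :=
    measurableSet_lt measurable_const measurable_norm
  have h1 : P {ω | s * √v < |r ω|} = gaussianReal 0 v.toNNReal {x | s * √v < |x|} := by
    rw [← h, Measure.map_apply_of_aemeasurable hr hmeas]
    rfl
  have h2 : gaussianReal 0 v.toNNReal = (gaussianReal 0 1).map (√v * ·) := by
    rw [gaussianReal_map_const_mul]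
    congr 1
    · simp
    · ext; simp [Real.sq_sqrt hv, hv]
  rw [h1, h2, Measure.map_apply (by fun_prop) hmeas]
  refine (measure_mono ?_).trans (gaussianReal_abs_gt_le hs)
  intro x hx
  simp only [Set.mem_preimage, Set.mem_ofPred_eq, abs_mul, abs_of_nonneg (Real.sqrt_nonneg v)] at hx
  rw [mul_comm] at hx
  exact lt_of_mul_lt_mul_left hx (Real.sqrt_nonneg v)

/-! ### Covariances of the observations -/

section Covariance

variable {Ω X : Type*} [MeasurableSpace Ω] {P : Measure Ω} [IsProbabilityMeasure P] {N : ℕ}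
  {k : X → X → ℝ} {g : Fin N → X → Ω → ℝ} {noise : ℕ → Fin N → Ω → ℝ} {η : ℝ}

omit [IsProbabilityMeasure P] in
lemma IsIIDGaussianProcess.covariance_ite (hg : IsIIDGaussianProcess P g k) (i j : Fin N)
    (x y : X) : covariance (g i x) (g j y) P = if i = j then k x y else 0 := by
  split_ifs with h
  · rw [h, hg.covariance_eq]
  · exact ((hg.indep.indepFun h).comp (measurable_pi_apply x) (measurable_pi_apply y)
      ).covariance_eq_zero (hg.memLp i x) (hg.memLp j y)

omit [IsProbabilityMeasure P] in
lemma IsNoise.hasGaussianLaw (hn : IsNoise P noise η g) (m : ℕ) (j : Fin N) :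
    HasGaussianLaw (noise m j) P where
  isGaussian_map := by rw [hn.law]; infer_instance

omit [IsProbabilityMeasure P] in
lemma IsNoise.memLp (hn : IsNoise P noise η g) (m : ℕ) (j : Fin N) : MemLp (noise m j) 2 P :=
  (hn.hasGaussianLaw m j).memLp_two

omit [IsProbabilityMeasure P] in
lemma IsNoise.integral_eq_zero (hn : IsNoise P noise η g) (m : ℕ) (j : Fin N) :
    ∫ ω, noise m j ω ∂P = 0 := by
  have := integral_id_gaussianReal (μ := 0) (v := (η ^ 2).toNNReal)
  rwa [← hn.law m j, integral_map (hn.measurable m j).aemeasurable (by fun_prop)] at this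

omit [IsProbabilityMeasure P] in
lemma IsNoise.covariance_ite (hn : IsNoise P noise η g) (p p' : ℕ × Fin N) :
    covariance (noise p.1 p.2) (noise p'.1 p'.2) P = if p = p' then η ^ 2 else 0 := by
  split_ifs with h
  · subst h
    rw [covariance_self (hn.measurable _ _).aemeasurable,
      ← variance_id_map (hn.measurable _ _).aemeasurable, hn.law, variance_id_gaussianReal,
      Real.coe_toNNReal _ (sq_nonneg η)]
  · exact (hn.indep.indepFun h).covariance_eq_zero (hn.memLp _ _) (hn.memLp _ _)

omit [IsProbabilityMeasure P] in
lemma IsNoise.covariance_process (hn : IsNoise P noise η g) (hg : IsIIDGaussianProcess P g k)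
    (i j : Fin N) (x : X) (m : ℕ) : covariance (g i x) (noise m j) P = 0 :=
  (hn.indep_process.comp (measurable_pi_apply (i, x)) (measurable_pi_apply (m, j))
    ).covariance_eq_zero (hg.memLp i x) (hn.memLp m j)

/-- The observations along the deterministic sequence of queries `xs`. -/
def pathObservation (g : Fin N → X → Ω → ℝ) (noise : ℕ → Fin N → Ω → ℝ) {m : ℕ} (xs : Fin m → X)
    (p : Fin m × Fin N) (ω : Ω) : ℝ :=
  g p.2 (xs p.1) ω + noise p.1 p.2 ω

omit [IsProbabilityMeasure P] in
lemma measurable_pathObservation (hn : IsNoise P noise η g) (hg : IsIIDGaussianProcess P g k)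
    {m : ℕ} (xs : Fin m → X) (p : Fin m × Fin N) : Measurable (pathObservation g noise xs p) :=
  (hg.measurable _ _).add (hn.measurable _ _)

omit [IsProbabilityMeasure P] in
lemma memLp_pathObservation (hn : IsNoise P noise η g) (hg : IsIIDGaussianProcess P g k)
    {m : ℕ} (xs : Fin m → X) (p : Fin m × Fin N) : MemLp (pathObservation g noise xs p) 2 P :=
  (hg.memLp _ _).add (hn.memLp _ _)

lemma covariance_process_pathObservation (hn : IsNoise P noise η g)
    (hg : IsIIDGaussianProcess P g k) {m : ℕ} (xs : Fin m → X) (j : Fin N) (x : X)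
    (p : Fin m × Fin N) :
    covariance (g j x) (pathObservation g noise xs p) P = if j = p.2 then k x (xs p.1) else 0 := by
  have : pathObservation g noise xs p = g p.2 (xs p.1) + noise p.1 p.2 := rfl
  rw [this, covariance_add_right (hg.memLp _ _) (hg.memLp _ _) (hn.memLp _ _),
    hn.covariance_process hg, hg.covariance_ite, add_zero]

lemma covariance_pathObservation (hn : IsNoise P noise η g)
    (hg : IsIIDGaussianProcess P g k) {m : ℕ} (xs : Fin m → X) (p p' : Fin m × Fin N) :
    covariance (pathObservation g noise xs p) (pathObservation g noise xs p') P =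
      if p.2 = p'.2 then
        (covMatrix k xs + η ^ 2 • (1 : Matrix (Fin m) (Fin m) ℝ)) p.1 p'.1 else 0 := by
  have h0 : pathObservation g noise xs p = g p.2 (xs p.1) + noise p.1 p.2 := rfl
  have h1 : pathObservation g noise xs p' = g p'.2 (xs p'.1) + noise p'.1 p'.2 := rfl
  rw [h0, covariance_add_left (hg.memLp _ _) (hn.memLp _ _) (memLp_pathObservation hn hg _ _),
    covariance_process_pathObservation hn hg, h1,
    covariance_add_right (hn.memLp _ _) (hg.memLp _ _) (hn.memLp _ _), covariance_comm (noise _ _),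
    hn.covariance_process hg, zero_add, hn.covariance_ite (p.1, p.2) (p'.1, p'.2)]
  simp only [covMatrix, Matrix.add_apply, Matrix.of_apply, Matrix.smul_apply, Matrix.one_apply,
    smul_eq_mul, mul_ite, mul_one, mul_zero, Prod.mk.injEq, Fin.val_inj]
  by_cases h : p.2 = p'.2 <;> simp [h]

/-! ### Covariance matrices -/

lemma IsIIDGaussianProcess.posSemidef_covMatrix (hg : IsIIDGaussianProcess P g k) (j : Fin N)
    {m : ℕ} (xs : Fin m → X) : (covMatrix k xs).PosSemidef := by
  refine Matrix.PosSemidef.of_dotProduct_mulVec_nonneg ?_ fun v => ?_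
  · ext a b
    simp [covMatrix, hg.kernel_comm j (xs b) (xs a)]
  · have := variance_nonneg (fun ω => ∑ a, v a * g j (xs a) ω) P
    rw [← covariance_self (Finset.aemeasurable_fun_sum _ fun a _ =>
      ((hg.measurable j (xs a)).const_mul _).aemeasurable),
      covariance_fun_sum_fun_sum (fun a => (hg.memLp j (xs a)).const_mul _)
      (fun a => (hg.memLp j (xs a)).const_mul _)] at this
    refine this.trans_eq ?_
    simp only [dotProduct, Matrix.mulVec, covMatrix, Matrix.of_apply, Finset.mul_sum, star_trivial]
    refine Finset.sum_congr rfl fun a _ => Finset.sum_congr rfl fun b _ => ?_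
    rw [covariance_const_mul_left, covariance_const_mul_right, hg.covariance_eq]
    ring

lemma posDef_covMatrix_add {η : ℝ} (hη : 0 < η) {m : ℕ} {xs : Fin m → X}
    (h : (covMatrix k xs).PosSemidef) :
    (covMatrix k xs + η ^ 2 • (1 : Matrix (Fin m) (Fin m) ℝ)).PosDef :=
  Matrix.PosDef.posSemidef_add h (Matrix.PosDef.one.smul (by positivity))

/-! ### The posterior residual -/

/-- The posterior variance at `x` given noisy values at the points `xs`. -/
def posteriorVar (k : X → X → ℝ) (η : ℝ) {m : ℕ} (xs : Fin m → X) (x : X) : ℝ :=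
  k x x - (fun a => k (xs a) x) ⬝ᵥ
    (Matrix.mulVec (covMatrix k xs + η ^ 2 • (1 : Matrix (Fin m) (Fin m) ℝ))⁻¹
      (fun a => k (xs a) x))

/-- The weights of the observations in the posterior mean. -/
def posteriorWeight (k : X → X → ℝ) (η : ℝ) {m : ℕ} (xs : Fin m → X) (x : X) : Fin m → ℝ :=
  Matrix.vecMul (fun a => k (xs a) x)
    (covMatrix k xs + η ^ 2 • (1 : Matrix (Fin m) (Fin m) ℝ))⁻¹

lemma posteriorMean_eq_sum (k : X → X → ℝ) (η : ℝ) {m : ℕ} (xs : Fin m → X) (ys : Fin m → ℝ)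
    (x : X) : posteriorMean k η xs ys x = ∑ l, posteriorWeight k η xs x l * ys l := by
  rw [posteriorMean, Matrix.dotProduct_mulVec]
  rfl

lemma posteriorVar_eq (k : X → X → ℝ) (η : ℝ) {m : ℕ} (xs : Fin m → X) (x : X) :
    posteriorVar k η xs x = k x x - ∑ l, posteriorWeight k η xs x l * k (xs l) x := by
  rw [posteriorVar, Matrix.dotProduct_mulVec]
  rfl

/-- The normal equations of the linear regression of `g_j(x)` on the observations. -/
lemma sum_posteriorWeight_mul {η : ℝ} (hη : 0 < η) {m : ℕ} {xs : Fin m → X}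
    (h : (covMatrix k xs).PosSemidef) (x : X) (b : Fin m) :
    ∑ l, posteriorWeight k η xs x l *
      (covMatrix k xs + η ^ 2 • (1 : Matrix (Fin m) (Fin m) ℝ)) l b = k (xs b) x := by
  have hu := (posDef_covMatrix_add hη h).isUnit
  have : Matrix.vecMul (posteriorWeight k η xs x)
      (covMatrix k xs + η ^ 2 • (1 : Matrix (Fin m) (Fin m) ℝ)) = fun a => k (xs a) x := by
    rw [posteriorWeight, Matrix.vecMul_vecMul,
      Matrix.nonsing_inv_mul _ ((Matrix.isUnit_iff_isUnit_det _).1 hu), Matrix.vecMul_one]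
  exact congrFun this b

/-- The posterior residual `g_j(x) - μ^j(x)` along a deterministic sequence of queries. -/
def residual (k : X → X → ℝ) (η : ℝ) (g : Fin N → X → Ω → ℝ) (noise : ℕ → Fin N → Ω → ℝ) {m : ℕ}
    (xs : Fin m → X) (j : Fin N) (x : X) (ω : Ω) : ℝ :=
  g j x ω - ∑ l, posteriorWeight k η xs x l * pathObservation g noise xs (l, j) ω

omit [MeasurableSpace Ω] in
lemma residual_eq (k : X → X → ℝ) (η : ℝ) (g : Fin N → X → Ω → ℝ) (noise : ℕ → Fin N → Ω → ℝ)
    {m : ℕ} (xs : Fin m → X) (j : Fin N) (x : X) (ω : Ω) :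
    residual k η g noise xs j x ω = g j x ω -
      posteriorMean k η xs (fun l => pathObservation g noise xs (l, j) ω) x := by
  rw [posteriorMean_eq_sum]
  rfl

section Residual

variable (hn : IsNoise P noise η g) (hg : IsIIDGaussianProcess P g k) {m : ℕ} (xs : Fin m → X)
  (j : Fin N) (x : X)

include hn hg

omit [IsProbabilityMeasure P] in
lemma measurable_residual : Measurable (residual k η g noise xs j x) :=
  (hg.measurable j x).sub (Finset.measurable_fun_sum _ fun l _ =>
    (measurable_pathObservation hn hg xs (l, j)).const_mul _)

omit [IsProbabilityMeasure P] in
lemma memLp_weighted_sum :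
    MemLp (fun ω => ∑ l, posteriorWeight k η xs x l * pathObservation g noise xs (l, j) ω) 2 P :=
  memLp_finsetSum _ fun l _ => (memLp_pathObservation hn hg xs (l, j)).const_mul _

lemma integral_residual : ∫ ω, residual k η g noise xs j x ω ∂P = 0 := by
  have hY : ∀ p, ∫ ω, pathObservation g noise xs p ω ∂P = 0 := by
    intro p
    simp only [pathObservation]
    rw [integral_add ((hg.memLp _ _).integrable one_le_two)
      ((hn.memLp _ _).integrable one_le_two), hg.mean_zero, hn.integral_eq_zero, add_zero]
  simp only [residual]
  rw [integral_sub ((hg.memLp _ _).integrable one_le_two)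
    ((memLp_weighted_sum hn hg xs j x).integrable one_le_two), hg.mean_zero,
    integral_finsetSum _ fun l _ =>
      ((memLp_pathObservation hn hg xs (l, j)).integrable one_le_two).const_mul _]
  simp [integral_const_mul, hY]

/-- For the same coordinate the normal equations give orthogonality; distinct coordinates are
uncorrelated from the start. -/
lemma covariance_residual_pathObservation (hη : 0 < η) (p : Fin m × Fin N) :
    covariance (residual k η g noise xs j x) (pathObservation g noise xs p) P = 0 := by
  have hY := memLp_pathObservation hn hg xs
  unfold residual
  rw [covariance_fun_sub_left (hg.memLp _ _) (memLp_weighted_sum hn hg xs j x) (hY p),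
    covariance_process_pathObservation hn hg, covariance_fun_sum_left
      (fun l => (hY (l, j)).const_mul _) (hY p)]
  simp only [covariance_const_mul_left, covariance_pathObservation hn hg]
  by_cases h : j = p.2
  · simp only [h, if_true]
    rw [sum_posteriorWeight_mul hη (hg.posSemidef_covMatrix j xs), hg.kernel_comm j, sub_self]
  · simp [h]

/-- The residual is orthogonal to the observations, so its variance equals its covariance with
`g_j(x)`. -/
lemma variance_residual (hη : 0 < η) :
    variance (residual k η g noise xs j x) P = posteriorVar k η xs x := by
  have hY := memLp_pathObservation hn hg xs
  have hr : MemLp (residual k η g noise xs j x) 2 P :=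
    (hg.memLp j x).sub (memLp_weighted_sum hn hg xs j x)
  rw [← covariance_self (measurable_residual hn hg xs j x).aemeasurable]
  conv_lhs => enter [2]; unfold residual
  rw [covariance_fun_sub_right hr (hg.memLp _ _) (memLp_weighted_sum hn hg xs j x),
    covariance_fun_sum_right (fun l => (hY (l, j)).const_mul _) hr]
  simp only [covariance_const_mul_right, covariance_residual_pathObservation hn hg xs j x hη,
    mul_zero, Finset.sum_const_zero, sub_zero]
  unfold residual
  rw [covariance_fun_sub_left (hg.memLp _ _) (memLp_weighted_sum hn hg xs j x) (hg.memLp _ _),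
    hg.covariance_eq, covariance_fun_sum_left
      (fun l => (hY (l, j)).const_mul _) (hg.memLp _ _)]
  rw [posteriorVar_eq]
  congr 1
  refine Finset.sum_congr rfl fun l _ => ?_
  rw [covariance_const_mul_left, covariance_comm, covariance_process_pathObservation hn hg,
    if_pos rfl, hg.kernel_comm j x]

include j in
lemma posteriorVar_nonneg (hη : 0 < η) : 0 ≤ posteriorVar k η xs x :=
  variance_residual hn hg xs j x hη ▸ variance_nonneg _ _

variable [Finite X]

omit [IsProbabilityMeasure P] in
lemma hasGaussianLaw_process_noise (m : ℕ) :
    HasGaussianLaw (fun ω => ((fun (j : Fin N) (x : X) => g j x ω),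
      (fun p : Fin m × Fin N => noise p.1 p.2 ω))) P := by
  have := Fintype.ofFinite X
  have h1 : HasGaussianLaw (fun ω (j : Fin N) (x : X) => g j x ω) P := by
    refine hg.indep.hasGaussianLaw fun j => ?_
    have := (hg.gaussian j).hasGaussianLaw Finset.univ
    exact this.map_fun (ContinuousLinearMap.pi fun x : X =>
      ContinuousLinearMap.proj (R := ℝ) (φ := fun _ : (Finset.univ : Finset X) => ℝ)
        ⟨x, Finset.mem_univ x⟩)
  have hinj : Function.Injective (fun p : Fin m × Fin N => ((p.1 : ℕ), p.2)) := by
    rintro ⟨a, b⟩ ⟨c, d⟩ h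
    simp only [Prod.mk.injEq, Fin.val_inj] at h
    simp [h.1, h.2]
  have h2 : HasGaussianLaw (fun ω (p : Fin m × Fin N) => noise p.1 p.2 ω) P :=
    (hn.indep.precomp hinj).hasGaussianLaw fun p => hn.hasGaussianLaw _ _
  refine IndepFun.hasGaussianLaw h1 h2 ?_
  exact hn.indep_process.comp (φ := fun (v : Fin N × X → ℝ) (j : Fin N) (x : X) => v (j, x))
    (ψ := fun (v : ℕ × Fin N → ℝ) (p : Fin m × Fin N) => v (p.1, p.2))
    (by fun_prop) (by fun_prop)

omit [IsProbabilityMeasure P] in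
lemma hasGaussianLaw_residual_pathObservation :
    HasGaussianLaw (fun ω => ((fun _ : Unit => residual k η g noise xs j x ω),
      (fun p => pathObservation g noise xs p ω))) P := by
  let ev (j : Fin N) (x : X) : ((Fin N → X → ℝ) × (Fin m × Fin N → ℝ)) →L[ℝ] ℝ :=
    (ContinuousLinearMap.proj (R := ℝ) (φ := fun _ : X => ℝ) x).comp
      ((ContinuousLinearMap.proj (R := ℝ) (φ := fun _ : Fin N => X → ℝ) j).comp
        (ContinuousLinearMap.fst ℝ _ _))
  let Y (p : Fin m × Fin N) : ((Fin N → X → ℝ) × (Fin m × Fin N → ℝ)) →L[ℝ] ℝ :=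
    ev p.2 (xs p.1) + (ContinuousLinearMap.proj (R := ℝ) (φ := fun _ : Fin m × Fin N => ℝ) p).comp
      (ContinuousLinearMap.snd ℝ _ _)
  -- Residual and observations form a linear image of the Gaussian vector of process and noise
  -- values. The index `Unit` makes the residual a family, as required by the criterion of
  -- independence from vanishing covariances.
  let L := (ContinuousLinearMap.pi fun _ : Unit =>
    ev j x - ∑ l, posteriorWeight k η xs x l • Y (l, j)).prod (ContinuousLinearMap.pi Y)
  have := Fintype.ofFinite X
  have := (hasGaussianLaw_process_noise hn hg m).map_fun L
  have e : (fun ω => ((fun _ : Unit => residual k η g noise xs j x ω),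
      (fun p => pathObservation g noise xs p ω))) =
      fun ω => L ((fun j x => g j x ω), (fun p => noise p.1 p.2 ω)) := by
    funext ω
    refine Prod.ext (funext fun _ => ?_) (funext fun p => ?_)
    · simp [L, ev, Y, residual, pathObservation, mul_add]
    · simp [L, ev, Y, pathObservation]
  rw [e]
  exact this

lemma indepFun_residual_pathObservation (hη : 0 < η) :
    IndepFun (residual k η g noise xs j x) (fun ω p => pathObservation g noise xs p ω) P := by
  have := (hasGaussianLaw_residual_pathObservation hn hg xs j x).indepFun_of_covariance_eval
    (X := fun _ : Unit => residual k η g noise xs j x)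
    (fun _ p => covariance_residual_pathObservation hn hg xs j x hη p)
  exact this.comp (φ := fun v : Unit → ℝ => v ()) (ψ := id) (by fun_prop) measurable_id

lemma map_residual (hη : 0 < η) :
    P.map (residual k η g noise xs j x) = gaussianReal 0 (posteriorVar k η xs x).toNNReal := by
  have h := (hasGaussianLaw_residual_pathObservation hn hg xs j x).fst.eval ()
  rw [h.map_eq_gaussianReal, integral_residual hn hg, variance_residual hn hg xs j x hη]

lemma measure_residual_gt_le (hη : 0 < η) {β : ℝ} (hβ : 0 ≤ β)
    {S : Set Ω} (hS : MeasurableSet[MeasurableSpace.comap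
      (fun ω p => pathObservation g noise xs p ω) inferInstance] S) :
    P (S ∩ {ω | β * √(posteriorVar k η xs x) < |residual k η g noise xs j x ω|}) ≤
      P S * ENNReal.ofReal (Real.exp (-β ^ 2 / 2)) := by
  obtain ⟨B, hB, rfl⟩ := hS
  have hmeas : MeasurableSet {r : ℝ | β * √(posteriorVar k η xs x) < |r|} :=
    measurableSet_lt measurable_const measurable_norm
  have := (indepFun_residual_pathObservation hn hg xs j x hη).symm.measure_inter_preimage_eq_mul
    B _ hB hmeas
  refine this.le.trans ?_
  gcongr
  exact measure_abs_gt_le_of_map_eq_gaussianReal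
    (measurable_residual hn hg xs j x).aemeasurable (posteriorVar_nonneg hn hg xs j x hη)
    (map_residual hn hg xs j x hη) hβ

end Residual

end Covariance

/-! ### Confidence intervals along adaptively chosen queries -/

section Confidence

variable {Ω X : Type*} [MeasurableSpace Ω] {P : Measure Ω} [IsProbabilityMeasure P] {N : ℕ}
  {k : X → X → ℝ} {g : Fin N → X → Ω → ℝ} {noise : ℕ → Fin N → Ω → ℝ} {η : ℝ} {q : ℕ → Ω → X}

omit [MeasurableSpace Ω] in
lemma history_eq_comap (obs : ℕ → Fin N → Ω → ℝ) (m : ℕ) :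
    history obs m = MeasurableSpace.comap (fun ω (p : Fin m × Fin N) => obs p.1 p.2 ω)
      inferInstance := by
  simp only [history, MeasurableSpace.pi, MeasurableSpace.comap_iSup, MeasurableSpace.comap_comp,
    iSup_prod]
  rfl

omit [MeasurableSpace Ω] in
lemma comap_pathObservation_mono (a : ℕ → X) (m : ℕ) :
    MeasurableSpace.comap (fun ω p => pathObservation g noise (fun l : Fin m => a l) p ω)
      inferInstance ≤
    MeasurableSpace.comap (fun ω p => pathObservation g noise (fun l : Fin (m + 1) => a l) p ω)
      inferInstance := by
  have : (fun ω p => pathObservation g noise (fun l : Fin m => a l) p ω) =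
      (fun (y : Fin (m + 1) × Fin N → ℝ) (p : Fin m × Fin N) => y (p.1.castSucc, p.2)) ∘
        (fun ω p => pathObservation g noise (fun l : Fin (m + 1) => a l) p ω) := rfl
  rw [this, ← MeasurableSpace.comap_comp]
  exact MeasurableSpace.comap_mono (Measurable.comap_le (by fun_prop))

omit [MeasurableSpace Ω] in
-- Adapted queries refer to the actual observations. Where the first `m` queries follow `a`, these
-- coincide with the observations along `a`, so the next choice is also an event of the path
-- observations.
lemma measurableSet_queries_eq
    (hq : ∀ m x, MeasurableSet[history (observation g noise q) m] {ω | q m ω = x})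
    (a : ℕ → X) (m : ℕ) :
    MeasurableSet[MeasurableSpace.comap
      (fun ω p => pathObservation g noise (fun l : Fin m => a l) p ω) inferInstance]
      {ω | ∀ l < m, q l ω = a l} := by
  induction m with
  | zero => simp
  | succ m ih =>
    obtain ⟨B, hB, hBq⟩ : MeasurableSet[MeasurableSpace.comap (fun ω (p : Fin m × Fin N) =>
        observation g noise q p.1 p.2 ω) inferInstance] {ω | q m ω = a m} := by
      rw [← history_eq_comap]; exact hq m (a m)
    have : {ω | ∀ l < m + 1, q l ω = a l} = {ω | ∀ l < m, q l ω = a l} ∩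
        (fun ω p => pathObservation g noise (fun l : Fin m => a l) p ω) ⁻¹' B := by
      ext ω
      simp only [Set.mem_ofPred_eq, Set.mem_inter_iff, Set.mem_preimage]
      rw [Nat.forall_lt_succ_right]
      refine and_congr_right fun h => ?_
      have h1 : q m ω = a m ↔ (fun p : Fin m × Fin N => observation g noise q p.1 p.2 ω) ∈ B :=
        (Set.ext_iff.1 hBq ω).symm
      rw [h1]
      have h2 : (fun p : Fin m × Fin N => observation g noise q p.1 p.2 ω) =
          fun p => pathObservation g noise (fun l : Fin m => a l) p ω := by
        funext p
        simp only [observation, pathObservation, h p.1 p.1.2]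
      rw [h2]
    rw [this]
    exact comap_pathObservation_mono a m _ (ih.inter ⟨B, hB, rfl⟩)

omit [MeasurableSpace Ω] in
lemma measurableSet_path_eq [Nonempty X] {m : ℕ}
    (hq : ∀ m x, MeasurableSet[history (observation g noise q) m] {ω | q m ω = x})
    (xs : Fin m → X) : MeasurableSet[MeasurableSpace.comap
      (fun ω p => pathObservation g noise xs p ω) inferInstance]
      {ω | (fun l : Fin m => q l ω) = xs} := by
  classical
  have h := measurableSet_queries_eq hq
    -- The values from index `m` on are never read, so an arbitrary point serves as default.
    (fun l => if hl : l < m then xs ⟨l, hl⟩ else Classical.arbitrary X) m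
  have h1 : (fun l : Fin m => if hl : (l : ℕ) < m then xs ⟨l, hl⟩ else Classical.arbitrary X)
      = xs := by
    funext l
    simp
  rw [h1] at h
  convert h using 1
  ext ω
  simp only [Set.mem_ofPred_eq, funext_iff]
  constructor
  · intro H l hl
    simpa [hl] using H ⟨l, hl⟩
  · intro H l
    simpa using H l l.2

lemma measure_posterior_deviation_le [Finite X] [Nonempty X] (hn : IsNoise P noise η g)
    (hg : IsIIDGaussianProcess P g k) (hη : 0 < η)
    (hq : ∀ m x, MeasurableSet[history (observation g noise q) m] {ω | q m ω = x})
    (m : ℕ) (j : Fin N) (x : X) {β : ℝ} (hβ : 0 ≤ β) :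
    P {ω | β * posteriorSD k η (fun l : Fin m => q l ω) x <
      |g j x ω - posteriorMean k η (fun l : Fin m => q l ω)
        (fun l : Fin m => observation g noise q l j ω) x|} ≤
      ENNReal.ofReal (Real.exp (-β ^ 2 / 2)) := by
  have := Fintype.ofFinite X
  have hmeas : ∀ xs : Fin m → X, MeasurableSet {ω | (fun l : Fin m => q l ω) = xs} := fun xs =>
    (measurable_pi_lambda _ fun p => measurable_pathObservation hn hg xs p).comap_le _
      (measurableSet_path_eq hq xs)
  calc _ ≤ P (⋃ xs : Fin m → X, {ω | (fun l : Fin m => q l ω) = xs} ∩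
        {ω | β * √(posteriorVar k η xs x) < |residual k η g noise xs j x ω|}) := by
        refine measure_mono fun ω hω => ?_
        refine Set.mem_iUnion.2 ⟨fun l : Fin m => q l ω, rfl, ?_⟩
        rw [Set.mem_ofPred_eq, residual_eq]
        exact hω
    _ ≤ ∑ xs : Fin m → X, P ({ω | (fun l : Fin m => q l ω) = xs} ∩
        {ω | β * √(posteriorVar k η xs x) < |residual k η g noise xs j x ω|}) :=
        measure_iUnion_fintype_le _ _
    _ ≤ ∑ xs : Fin m → X, P {ω | (fun l : Fin m => q l ω) = xs} *
        ENNReal.ofReal (Real.exp (-β ^ 2 / 2)) :=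
        Finset.sum_le_sum fun xs _ =>
          measure_residual_gt_le hn hg xs j x hη hβ (measurableSet_path_eq hq xs)
    -- The path events are disjoint: their probabilities add up to at most 1, and the number of
    -- paths costs nothing.
    _ = P (⋃ xs : Fin m → X, {ω | (fun l : Fin m => q l ω) = xs}) *
        ENNReal.ofReal (Real.exp (-β ^ 2 / 2)) := by
        rw [← Finset.sum_mul, measure_iUnion _ hmeas, tsum_fintype]
        intro xs ys hne
        rw [Function.onFun, Set.disjoint_left]
        intro ω h1 h2
        exact hne (h1.symm.trans h2)
    _ ≤ 1 * ENNReal.ofReal (Real.exp (-β ^ 2 / 2)) := by gcongr; exact prob_le_one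
    _ = _ := one_mul _

end Confidence

/-! ### Zeta normalization and the union bound over rounds, nodes and coordinates. -/

lemma hasSum_one_div_rpow_zeta {a : ℝ} (ha : 1 < a) :
    HasSum (fun m : ℕ => 1 / ((m + 1 : ℕ) : ℝ) ^ a) (riemannZeta (a : ℂ)).re := by
  have hs : Summable (fun m : ℕ => 1 / ((m + 1 : ℕ) : ℝ) ^ a) :=
    (summable_nat_add_iff (f := fun n : ℕ => 1 / (n : ℝ) ^ a) 1).2
      (Real.summable_one_div_nat_rpow.2 ha)
  have hz : riemannZeta (a : ℂ) = ((∑' m : ℕ, 1 / ((m + 1 : ℕ) : ℝ) ^ a : ℝ) : ℂ) := by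
    rw [zeta_eq_tsum_one_div_nat_add_one_cpow (by simpa using ha), Complex.ofReal_tsum]
    congr 1
    ext m
    push_cast
    rw [Complex.ofReal_cpow (by positivity)]
    push_cast
    rfl
  rw [hz, Complex.ofReal_re]
  exact hs.hasSum

lemma one_le_zeta_re {a : ℝ} (ha : 1 < a) : 1 ≤ (riemannZeta (a : ℂ)).re := by
  simpa using le_hasSum (hasSum_one_div_rpow_zeta ha) 0 fun m _ => by positivity

section Union

variable {X : Type*} [Fintype X]

omit [Fintype X] in
lemma levelExponent_nonneg (d : X → X → ℝ) (h : ℕ) : 0 ≤ levelExponent d h :=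
  mul_nonneg zero_le_two (Real.log_natCast_nonneg _)

lemma log_rpow_mul_zeta_nonneg {a : ℝ} (ha : 1 < a) {i : ℕ} (hi : 1 ≤ i) :
    0 ≤ Real.log ((i : ℝ) ^ a * (riemannZeta (a : ℂ)).re) := by
  have h1 : 1 ≤ (i : ℝ) ^ a := Real.one_le_rpow (by exact_mod_cast hi) (by linarith)
  exact Real.log_nonneg (one_le_mul_of_one_le_of_one_le h1 (one_le_zeta_re ha))

omit [Fintype X] in
lemma confidenceLevel_nonneg (d : X → X → ℝ) {u a : ℝ} (hu : 0 ≤ u) (ha : 1 < a) {i : ℕ}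
    (hi : 1 ≤ i) : 0 ≤ confidenceLevel d u a i :=
  add_nonneg (add_nonneg hu (levelExponent_nonneg _ _)) (log_rpow_mul_zeta_nonneg ha hi)

lemma sq_confidenceFactor {N : ℕ} {v : ℝ} (hv : 0 ≤ v) :
    confidenceFactor N v ^ 2 = 2 * (v + Real.log N) :=
  Real.sq_sqrt (mul_nonneg zero_le_two (add_nonneg hv (Real.log_natCast_nonneg _)))

omit [Fintype X] in
-- The failure budget of round `i`: at most `e^{n_h}` nodes and `N` coordinates, each with tail
-- `e^{-(u_i + log N)}`. The right-hand sides sum to `e^{-u}` over `i ≥ 1`.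
lemma exp_confidenceLevel_mul (d : X → X → ℝ) (u : ℝ) {a : ℝ} (ha : 1 < a) {N : ℕ} (hN : 1 ≤ N)
    {i : ℕ} (hi : 1 ≤ i) :
    Real.exp (levelExponent d (depth i)) *
        (N * Real.exp (-(confidenceLevel d u a i + Real.log N))) =
      Real.exp (-u) * ((1 / (i : ℝ) ^ a) / (riemannZeta (a : ℂ)).re) := by
  have hz := one_le_zeta_re ha
  have hi' : 0 < (i : ℝ) ^ a := Real.rpow_pos_of_pos (by exact_mod_cast hi) _
  have hN' : (0 : ℝ) < N := by exact_mod_cast hN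
  have : -(confidenceLevel d u a i + Real.log N) = -u + -levelExponent d (depth i) +
      -Real.log ((i : ℝ) ^ a * (riemannZeta (a : ℂ)).re) + -Real.log N := by
    rw [confidenceLevel]; ring
  rw [this, Real.exp_add, Real.exp_add, Real.exp_add, Real.exp_neg (Real.log _),
    Real.exp_neg (Real.log N), Real.exp_log hN', Real.exp_log (by positivity),
    Real.exp_neg (levelExponent d _)]
  have := (Real.exp_pos (levelExponent d (depth i))).ne'
  field_simp

variable {Ω : Type*} [MeasurableSpace Ω] {P : Measure Ω} [IsProbabilityMeasure P] {N : ℕ}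
  {k : X → X → ℝ} {g : Fin N → X → Ω → ℝ} {noise : ℕ → Fin N → Ω → ℝ} {η : ℝ} {q : ℕ → Ω → X}

/-- The event that all the confidence intervals used by the algorithm hold. -/
def ConfidenceHolds (k : X → X → ℝ) {d : X → X → ℝ} (η u a : ℝ) (g : Fin N → X → Ω → ℝ)
    (noise : ℕ → Fin N → Ω → ℝ) (T : ChainingTree d) (q : ℕ → Ω → X) (ω : Ω) : Prop :=
  ∀ m, ∀ x ∈ T.level (depth (m + 1)), ∀ j,
    |g j x ω - posteriorMean k η (fun l : Fin m => q l ω)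
        (fun l : Fin m => observation g noise q l j ω) x| ≤
      confidenceFactor N (confidenceLevel d u a (m + 1)) *
        posteriorSD k η (fun l : Fin m => q l ω) x

theorem measure_not_confidenceHolds_le [Nonempty X] (hn : IsNoise P noise η g)
    (hg : IsIIDGaussianProcess P g k) (hη : 0 < η) (hN : 1 ≤ N) {u a : ℝ} (hu : 0 ≤ u)
    (ha : 1 < a) {d : X → X → ℝ} (T : ChainingTree d)
    (hq : ∀ m x, MeasurableSet[history (observation g noise q) m] {ω | q m ω = x}) :
    P {ω | ¬ ConfidenceHolds k η u a g noise T q ω} ≤ ENNReal.ofReal (Real.exp (-u)) := by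
  have hsum := (hasSum_one_div_rpow_zeta ha).div_const (riemannZeta (a : ℂ)).re |>.mul_left
    (Real.exp (-u))
  have hz := one_le_zeta_re ha
  rw [div_self (by linarith), mul_one] at hsum
  let bad (m : ℕ) (x : X) (j : Fin N) : Set Ω :=
    {ω | confidenceFactor N (confidenceLevel d u a (m + 1)) *
        posteriorSD k η (fun l : Fin m => q l ω) x <
      |g j x ω - posteriorMean k η (fun l : Fin m => q l ω)
        (fun l : Fin m => observation g noise q l j ω) x|}
  have hbad : ∀ m x j, P (bad m x j) ≤
      ENNReal.ofReal (Real.exp (-(confidenceLevel d u a (m + 1) + Real.log N))) := by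
    intro m x j
    have h := measure_posterior_deviation_le hn hg hη hq m j x
      (β := confidenceFactor N (confidenceLevel d u a (m + 1))) (Real.sqrt_nonneg _)
    rw [sq_confidenceFactor (confidenceLevel_nonneg d hu ha (Nat.le_add_left 1 m))] at h
    convert h using 4
    ring
  calc P {ω | ¬ ConfidenceHolds k η u a g noise T q ω}
      ≤ P (⋃ m, ⋃ x ∈ T.level (depth (m + 1)), ⋃ j, bad m x j) := by
        refine measure_mono fun ω hω => ?_
        simp only [ConfidenceHolds, Set.mem_ofPred_eq, not_forall, not_le] at hω
        obtain ⟨m, x, hx, j, hj⟩ := hω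
        exact Set.mem_iUnion.2 ⟨m, Set.mem_iUnion₂.2 ⟨x, hx, Set.mem_iUnion.2 ⟨j, hj⟩⟩⟩
    _ ≤ ∑' m, P (⋃ x ∈ T.level (depth (m + 1)), ⋃ j, bad m x j) := measure_iUnion_le _
    _ ≤ ∑' m : ℕ, ENNReal.ofReal (Real.exp (-u) *
          ((1 / ((m + 1 : ℕ) : ℝ) ^ a) / (riemannZeta (a : ℂ)).re)) := by
        refine ENNReal.tsum_le_tsum fun m => ?_
        calc _ ≤ ∑ x ∈ T.level (depth (m + 1)), P (⋃ j, bad m x j) :=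
              measure_biUnion_finset_le _ _
          _ ≤ ∑ x ∈ T.level (depth (m + 1)), ∑ j, P (bad m x j) :=
              Finset.sum_le_sum fun x _ => measure_iUnion_fintype_le _ _
          _ ≤ ∑ x ∈ T.level (depth (m + 1)), ∑ j : Fin N,
              ENNReal.ofReal (Real.exp (-(confidenceLevel d u a (m + 1) + Real.log N))) :=
              Finset.sum_le_sum fun x _ => Finset.sum_le_sum fun j _ => hbad m x j
          _ = ENNReal.ofReal ((T.level (depth (m + 1))).card *
              (N * Real.exp (-(confidenceLevel d u a (m + 1) + Real.log N)))) := by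
              simp only [Finset.sum_const, Finset.card_univ, Fintype.card_fin, nsmul_eq_mul]
              rw [ENNReal.ofReal_mul (by positivity), ENNReal.ofReal_mul (by positivity),
                ENNReal.ofReal_natCast, ENNReal.ofReal_natCast]
          _ ≤ _ := by
              refine ENNReal.ofReal_le_ofReal ?_
              rw [← exp_confidenceLevel_mul d u ha hN (Nat.le_add_left 1 m)]
              gcongr
              exact T.card_le _
    _ = ENNReal.ofReal (Real.exp (-u)) := by
        rw [← ENNReal.ofReal_tsum_of_nonneg (fun m => by positivity) hsum.summable,
          hsum.tsum_eq]

end Union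

/-! ### Information gain and posterior variances -/

section InformationGain

variable {X : Type*} {k : X → X → ℝ} {η : ℝ}

/-- The Schur complement of the first `m` observations in the enlarged matrix is the predictive
variance of the new one. -/
lemma det_covMatrix_succ (hη : 0 < η) (hsymm : ∀ x y, k x y = k y x) (a : ℕ → X) (m : ℕ)
    (hpsd : (covMatrix k (fun l : Fin m => a l)).PosSemidef) :
    (covMatrix k (fun l : Fin (m + 1) => a l) +
        η ^ 2 • (1 : Matrix (Fin (m + 1)) (Fin (m + 1)) ℝ)).det =
      (covMatrix k (fun l : Fin m => a l) + η ^ 2 • (1 : Matrix (Fin m) (Fin m) ℝ)).det *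
        (η ^ 2 + posteriorVar k η (fun l : Fin m => a l) (a m)) := by
  have hu := (posDef_covMatrix_add hη hpsd).isUnit
  let A := covMatrix k (fun l : Fin m => a l) + η ^ 2 • (1 : Matrix (Fin m) (Fin m) ℝ)
  have hdet : IsUnit A.det := (Matrix.isUnit_iff_isUnit_det _).1 hu
  let : Invertible A := A.invertibleOfIsUnitDet hdet
  let B : Matrix (Fin m) (Fin 1) ℝ := Matrix.of fun l _ => k (a l) (a m)
  let C : Matrix (Fin 1) (Fin m) ℝ := Matrix.of fun _ l => k (a l) (a m)
  let D : Matrix (Fin 1) (Fin 1) ℝ := Matrix.of fun _ _ => k (a m) (a m) + η ^ 2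
  have hblock : (covMatrix k (fun l : Fin (m + 1) => a l) +
      η ^ 2 • (1 : Matrix (Fin (m + 1)) (Fin (m + 1)) ℝ)).submatrix finSumFinEquiv
        finSumFinEquiv = Matrix.fromBlocks A B C D := by
    ext i j
    rcases i with i | i <;> rcases j with j | j
    · simp [A, covMatrix, Matrix.one_apply, Fin.ext_iff]
    · have : (i : ℕ) ≠ m := i.2.ne
      simp [B, covMatrix, Fin.ext_iff, this]
    · have : m ≠ (j : ℕ) := j.2.ne'
      simp [C, covMatrix, Fin.ext_iff, this, hsymm (a m)]
    · simp [D, covMatrix, Matrix.one_apply, Fin.ext_iff]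
  rw [← Matrix.det_submatrix_equiv_self finSumFinEquiv, hblock, Matrix.det_fromBlocks₁₁,
    Matrix.det_fin_one, Matrix.invOf_eq_nonsing_inv]
  congr 1
  rw [posteriorVar, Matrix.dotProduct_mulVec]
  simp only [Matrix.sub_apply, D, Matrix.of_apply]
  rw [add_sub_right_comm, add_comm]
  congr 2

lemma one_add_smul_covMatrix (hη : 0 < η) {m : ℕ} (xs : Fin m → X) :
    (1 + (η ^ 2)⁻¹ • covMatrix k xs).det =
      ((η ^ 2)⁻¹) ^ m * (covMatrix k xs + η ^ 2 • (1 : Matrix (Fin m) (Fin m) ℝ)).det := by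
  have h := Matrix.det_smul (covMatrix k xs + η ^ 2 • (1 : Matrix (Fin m) (Fin m) ℝ)) (η ^ 2)⁻¹
  rw [Fintype.card_fin] at h
  rw [← h, smul_add, smul_smul, inv_mul_cancel₀ (by positivity), one_smul, add_comm]

lemma log_det_eq_sum (hη : 0 < η) (hsymm : ∀ x y, k x y = k y x)
    (hpsd : ∀ (m : ℕ) (xs : Fin m → X), (covMatrix k xs).PosSemidef)
    (hvar : ∀ (m : ℕ) (xs : Fin m → X) (x : X), 0 ≤ posteriorVar k η xs x) (a : ℕ → X) (t : ℕ) :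
    Real.log (1 + (η ^ 2)⁻¹ • covMatrix k (fun l : Fin t => a l)).det =
      ∑ m ∈ Finset.range t,
        Real.log (1 + posteriorVar k η (fun l : Fin m => a l) (a m) / η ^ 2) := by
  induction t with
  | zero => simp
  | succ t ih =>
    have hpos : 0 < (covMatrix k (fun l : Fin t => a l) +
        η ^ 2 • (1 : Matrix (Fin t) (Fin t) ℝ)).det := (posDef_covMatrix_add hη (hpsd t _)).det_pos
    have h1 : 0 < 1 + posteriorVar k η (fun l : Fin t => a l) (a t) / η ^ 2 := by
      have := hvar t (fun l : Fin t => a l) (a t)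
      positivity
    rw [Finset.sum_range_succ, ← ih, one_add_smul_covMatrix hη,
      det_covMatrix_succ hη hsymm a t (hpsd t _), one_add_smul_covMatrix hη,
      ← Real.log_mul (by positivity) h1.ne']
    have e : (η ^ 2)⁻¹ * (η ^ 2 + posteriorVar k η (fun l : Fin t => a l) (a t)) =
        1 + posteriorVar k η (fun l : Fin t => a l) (a t) / η ^ 2 := by field_simp
    rw [pow_succ, ← e]
    congr 1
    ring

variable [Finite X]

lemma half_log_det_le_maxInfoGain {t : ℕ} (xs : Fin t → X) :
    (1 / 2) * Real.log (1 + (η ^ 2)⁻¹ • covMatrix k xs).det ≤ maxInfoGain k η t :=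
  le_ciSup (f := fun xs : Fin t → X => (1 / 2) * Real.log (1 + (η ^ 2)⁻¹ • covMatrix k xs).det)
    (Set.finite_range _).bddAbove xs

/-- `log(1 + s) ≥ s/(1 + s)` with `s = v/η²`; boundedness of `v` makes the loss a constant factor.
-/
lemma posteriorVar_le_log {κ v : ℝ} (hη : 0 < η) (hv : 0 ≤ v) (hvκ : v ≤ κ) :
    v ≤ (η ^ 2 + κ) * Real.log (1 + v / η ^ 2) := by
  have hlog := Real.one_sub_inv_le_log_of_pos (x := 1 + v / η ^ 2) (by positivity)
  have h1 : 1 - (1 + v / η ^ 2)⁻¹ = v / (η ^ 2 + v) := by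
    have : η ^ 2 + v ≠ 0 := by positivity
    field_simp
    ring
  rw [h1] at hlog
  calc v = (η ^ 2 + v) * (v / (η ^ 2 + v)) := by
        have : η ^ 2 + v ≠ 0 := by positivity
        field_simp
    _ ≤ (η ^ 2 + κ) * (v / (η ^ 2 + v)) := by gcongr
    _ ≤ _ := by
        have : 0 ≤ η ^ 2 + κ := by nlinarith [sq_nonneg η]
        gcongr

omit [Finite X] in
lemma posteriorVar_le (hη : 0 < η) {m : ℕ} {xs : Fin m → X}
    (hpsd : (covMatrix k xs).PosSemidef) (x : X) : posteriorVar k η xs x ≤ k x x := by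
  have := (posDef_covMatrix_add hη hpsd).inv.posSemidef.dotProduct_mulVec_nonneg
    (fun a => k (xs a) x)
  rw [posteriorVar]
  rw [star_trivial] at this
  linarith

theorem sum_posteriorVar_le {κ : ℝ} (hη : 0 < η) (hκ : ∀ x, k x x = κ)
    (hsymm : ∀ x y, k x y = k y x)
    (hpsd : ∀ (m : ℕ) (xs : Fin m → X), (covMatrix k xs).PosSemidef)
    (hvar : ∀ (m : ℕ) (xs : Fin m → X) (x : X), 0 ≤ posteriorVar k η xs x) (a : ℕ → X) (t : ℕ) :
    ∑ m ∈ Finset.range t, posteriorVar k η (fun l : Fin m => a l) (a m) ≤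
      2 * (η ^ 2 + κ) * maxInfoGain k η t := by
  have hle : ∀ (m : ℕ) (xs : Fin m → X) (x : X), posteriorVar k η xs x ≤ κ := fun m xs x =>
    (posteriorVar_le hη (hpsd m xs) x).trans_eq (hκ x)
  have hκ0 : 0 ≤ κ := (hvar 0 (fun l : Fin 0 => a l) (a 0)).trans (hle _ _ _)
  have h1 := half_log_det_le_maxInfoGain (k := k) (η := η) (fun l : Fin t => a l)
  rw [log_det_eq_sum hη hsymm hpsd hvar] at h1
  calc _ ≤ ∑ m ∈ Finset.range t, (η ^ 2 + κ) *
          Real.log (1 + posteriorVar k η (fun l : Fin m => a l) (a m) / η ^ 2) :=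
        Finset.sum_le_sum fun m _ => posteriorVar_le_log hη (hvar _ _ _) (hle _ _ _)
    _ = 2 * (η ^ 2 + κ) * (1 / 2 * ∑ m ∈ Finset.range t,
          Real.log (1 + posteriorVar k η (fun l : Fin m => a l) (a m) / η ^ 2)) := by
        rw [← Finset.mul_sum]; ring
    _ ≤ _ := by gcongr

/-- The first observation already brings this much information. The uniform lower bound lets the
`γ_t` term absorb constants when `t ≤ N`, in particular at `t = 1`, where `log t = 0`. -/
theorem half_log_le_maxInfoGain [Nonempty X] {κ : ℝ} (hη : 0 < η) (hκ : ∀ x, k x x = κ)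
    (hsymm : ∀ x y, k x y = k y x)
    (hpsd : ∀ (m : ℕ) (xs : Fin m → X), (covMatrix k xs).PosSemidef)
    (hvar : ∀ (m : ℕ) (xs : Fin m → X) (x : X), 0 ≤ posteriorVar k η xs x) {t : ℕ} (ht : 1 ≤ t) :
    1 / 2 * Real.log (1 + κ / η ^ 2) ≤ maxInfoGain k η t := by
  let a : ℕ → X := fun _ => Classical.arbitrary X
  have h1 := half_log_det_le_maxInfoGain (k := k) (η := η) (fun l : Fin t => a l)
  rw [log_det_eq_sum hη hsymm hpsd hvar] at h1
  refine le_trans ?_ h1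
  gcongr
  have h0 : posteriorVar k η (fun l : Fin 0 => a l) (a 0) = κ := by
    simp [posteriorVar, hκ]
  rw [← h0]
  refine Finset.single_le_sum (f := fun m =>
    Real.log (1 + posteriorVar k η (fun l : Fin m => a l) (a m) / η ^ 2)) (fun m _ => ?_)
    (Finset.mem_range.2 ht)
  refine Real.log_nonneg ?_
  have := hvar m (fun l : Fin m => a l) (a m)
  simp only [le_add_iff_nonneg_right]
  positivity

end InformationGain

/-! ### Chaining -/

section SubGamma

variable {Ω X : Type*} [MeasurableSpace Ω] {P : Measure Ω} [IsProbabilityMeasure P] {N : ℕ}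
  {f : X → Ω → ℝ} {d : X → X → ℝ}

lemma IsSubGammaProcess.measure_ge_le (hf : IsSubGammaProcess P f d N 1) (hN : 1 ≤ N) {x y : X}
    (hd : 0 < d x y) (v : ℝ) :
    P {ω | 2 * √N * d x y * (v + 1 / 4) ≤ f x ω - f y ω} ≤ ENNReal.ofReal (Real.exp (-v)) := by
  have hN1 : 1 ≤ √(N : ℝ) := Real.one_le_sqrt.2 (by exact_mod_cast hN)
  have hN0 : 0 < √(N : ℝ) := by linarith
  have hNN : √(N : ℝ) ^ 2 = N := Real.sq_sqrt (Nat.cast_nonneg N)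
  -- Chernoff at `l = 1/(2 √N d)`: then `N l² d² = 1/4` and `l d ≤ 1/2`, so the log-moment is at
  -- most `1/4`, the shift added to `v`.
  obtain ⟨z, hz⟩ : ∃ z, z = (2 * √(N : ℝ))⁻¹ := ⟨_, rfl⟩
  obtain ⟨l, hl⟩ : ∃ l, l = z / d x y := ⟨_, rfl⟩
  have hz0 : 0 < z := by rw [hz]; positivity
  have hz1 : z ≤ 1 / 2 := by
    rw [hz, inv_eq_one_div]
    exact one_div_le_one_div_of_le two_pos (by linarith)
  have hl0 : 0 ≤ l := by rw [hl]; positivity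
  have hld : l * d x y = z := by rw [hl]; field_simp
  have hNz : N * z ^ 2 = 1 / 4 := by
    rw [hz, inv_pow, mul_pow, hNN]
    field_simp
    norm_num
  have hlt : 1 * l * d x y < 1 := by rw [one_mul, hld]; linarith
  have h1 := measure_ge_le_exp_cgf (2 * √N * d x y * (v + 1 / 4)) hl0
    (hf.integrable_exp x y l hl0 hlt)
  have h2 := hf.cgf_le x y l hl0 hlt
  have h3 : N * l ^ 2 * d x y ^ 2 / (2 * (1 - 1 * l * d x y)) ≤ 1 / 4 := by
    rw [mul_assoc (N : ℝ), ← mul_pow, one_mul, hld, hNz, div_le_iff₀ (by linarith)]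
    linarith
  have h4 : -l * (2 * √N * d x y * (v + 1 / 4)) = -(v + 1 / 4) := by
    calc _ = -((2 * √N) * (l * d x y) * (v + 1 / 4)) := by ring
      _ = _ := by
        rw [hld, hz, mul_inv_cancel₀ (by positivity), one_mul]
  rw [h4] at h1
  rw [← ofReal_measureReal]
  exact ENNReal.ofReal_le_ofReal (h1.trans (Real.exp_le_exp.2 (by linarith)))

lemma IsSubGammaProcess.mgf_le_one (hf : IsSubGammaProcess P f d N 1) {x y : X} (hd : d x y = 0) :
    ∫ ω, Real.exp (f x ω - f y ω) ∂P ≤ 1 := by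
  have hint := hf.integrable_exp x y 1 zero_le_one (by simp [hd])
  have h := hf.cgf_le x y 1 zero_le_one (by simp [hd])
  have hpos := mgf_pos hint
  simp only [hd, cgf] at h
  norm_num at h
  have := (Real.log_nonpos_iff hpos.le).1 h
  simpa [mgf] using this

/-- At distance zero `l = 1` is admissible and both `E e^{f(x)-f(y)}` and `E e^{f(y)-f(x)}` are at
most 1, whereas `e^s + e^{-s} ≥ 2` with equality only at `s = 0`. -/
lemma IsSubGammaProcess.ae_eq_of_dist_eq_zero (hf : IsSubGammaProcess P f d N 1) {x y : X}
    (hd : d x y = 0) : ∀ᵐ ω ∂P, f x ω = f y ω := by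
  have hd' : d y x = 0 := by rw [hf.dist_comm, hd]
  have hi1 : Integrable (fun ω => Real.exp (f x ω - f y ω)) P := by
    simpa using hf.integrable_exp x y 1 zero_le_one (by simp [hd])
  have hi2 : Integrable (fun ω => Real.exp (f y ω - f x ω)) P := by
    simpa using hf.integrable_exp y x 1 zero_le_one (by simp [hd'])
  have h1 := hf.mgf_le_one hd
  have h2 := hf.mgf_le_one hd'
  have hnn : ∀ ω, 0 ≤ Real.exp (f x ω - f y ω) + Real.exp (f y ω - f x ω) - 2 := by
    intro ω
    linarith [Real.add_one_le_exp (f x ω - f y ω), Real.add_one_le_exp (f y ω - f x ω)]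
  have hint := (hi1.add hi2).sub (integrable_const (2 : ℝ))
  have h0 : ∫ ω, (Real.exp (f x ω - f y ω) + Real.exp (f y ω - f x ω) - 2) ∂P = 0 := by
    refine le_antisymm ?_ (integral_nonneg hnn)
    rw [integral_sub (f := fun ω => Real.exp (f x ω - f y ω) + Real.exp (f y ω - f x ω))
      (hi1.add hi2) (integrable_const _), integral_add hi1 hi2]
    simp
    linarith
  have := (integral_eq_zero_iff_of_nonneg hnn hint).1 h0
  filter_upwards [this] with ω hω
  simp only [Pi.zero_apply] at hω
  by_contra hne
  have h3 := Real.add_one_lt_exp (sub_ne_zero.2 hne)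
  linarith [Real.add_one_le_exp (f y ω - f x ω)]

lemma IsSubGammaProcess.measure_abs_gt_le (hf : IsSubGammaProcess P f d N 1) (hN : 1 ≤ N)
    (x y : X) (v : ℝ) :
    P {ω | 2 * √N * d x y * (v + 1 / 4) < |f x ω - f y ω|} ≤
      ENNReal.ofReal (2 * Real.exp (-v)) := by
  rcases (hf.dist_nonneg x y).eq_or_lt with hd | hd
  · have : P {ω | 2 * √N * d x y * (v + 1 / 4) < |f x ω - f y ω|} = 0 := by
      rw [← hd]
      refine measure_mono_null ?_ (ae_iff.1 (hf.ae_eq_of_dist_eq_zero hd.symm))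
      intro ω hω heq
      simp [heq] at hω
    rw [this]
    exact zero_le
  · have hd' : 0 < d y x := by rwa [hf.dist_comm]
    calc _ ≤ P ({ω | 2 * √N * d x y * (v + 1 / 4) ≤ f x ω - f y ω} ∪
          {ω | 2 * √N * d y x * (v + 1 / 4) ≤ f y ω - f x ω}) := by
          refine measure_mono fun ω hω => ?_
          rw [hf.dist_comm y x]
          simp only [Set.mem_ofPred_eq, lt_abs, neg_sub] at hω
          exact hω.imp le_of_lt le_of_lt
      _ ≤ ENNReal.ofReal (Real.exp (-v)) + ENNReal.ofReal (Real.exp (-v)) :=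
          (measure_union_le _ _).trans
            (add_le_add (hf.measure_ge_le hN hd v) (hf.measure_ge_le hN hd' v))
      _ = _ := by
          rw [← ENNReal.ofReal_add (by positivity) (by positivity), two_mul]

end SubGamma

section Diameter

variable {X : Type*} [Finite X] {d : X → X → ℝ}

lemma le_diameter (x y : X) : d x y ≤ diameter d :=
  le_ciSup (f := fun p : X × X => d p.1 p.2) (Set.finite_range _).bddAbove (x, y)

end Diameter

/-! ### Covering numbers and the union bound over the edges of the tree. -/

section Chaining

variable {Ω X : Type*} [MeasurableSpace Ω] {P : Measure Ω} [IsProbabilityMeasure P] [Fintype X]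
  {N : ℕ} {d : X → X → ℝ}

omit [Fintype X] in
lemma coveringNumber_le_card {ε : ℝ} {S : Finset X} (hS : IsNet d ε S) :
    coveringNumber d ε ≤ S.card :=
  Nat.sInf_le ⟨S, hS, rfl⟩

lemma coveringNumber_le_one [Nonempty X] {ε : ℝ} (h : diameter d ≤ ε) :
    coveringNumber d ε ≤ 1 :=
  coveringNumber_le_card (S := {Classical.arbitrary X})
    fun _ => ⟨_, Finset.mem_singleton_self _, (le_diameter _ _).trans h⟩

lemma levelExponent_eq_zero [Nonempty X] {h : ℕ} (hh : diameter d ≤ radius d h) :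
    levelExponent d h = 0 := by
  have := coveringNumber_le_one hh
  rw [levelExponent]
  interval_cases coveringNumber d (radius d h) <;> simp

lemma ChainingTree.card_level_zero_le [Nonempty X] (T : ChainingTree d) :
    (T.level 0).card ≤ 1 := by
  have := T.card_le 0
  rw [levelExponent_eq_zero (by simp [radius]), Real.exp_zero] at this
  exact_mod_cast this

omit [Fintype X] in
lemma ChainingTree.dist_parent_le (T : ChainingTree d) {h : ℕ} {x : X}
    (hx : x ∈ T.level (h + 1)) : d x (T.parent h x) ≤ radius d h := by
  obtain ⟨s, hs, hds⟩ := T.isNet h x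
  exact (T.parent_closest h x hx s hs).trans hds

/-- The exponent of the deviation of the increments between the levels `h + 1` and `h`. -/
def chainingLevel (d : X → X → ℝ) (u : ℝ) (h : ℕ) : ℝ :=
  u + levelExponent d (h + 1) + (h + 1) * Real.log 2 + Real.log 4

/-- The event that all the increments along the tree are controlled, that points at distance zero
have the same image, and that `f` is controlled at the root. -/
structure ChainingHolds (d : X → X → ℝ) (κ u : ℝ) (g : Fin N → X → Ω → ℝ)
    (T : ChainingTree d) (ω : Ω) : Prop where
  increment : ∀ h, ∀ s ∈ T.level (h + 1),
    |objective g s ω - objective g (T.parent h s) ω| ≤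
      2 * √N * d s (T.parent h s) * (chainingLevel d u h + 1 / 4)
  eq_of_dist_eq_zero : ∀ x y, d x y = 0 → objective g x ω = objective g y ω
  root : ∀ s ∈ T.level 0, -objective g s ω ≤ 2 * Real.exp u * (κ + 1) * N

omit [Fintype X] in
-- The failure budget of level `h + 1`, with the two-sided factor 2; it sums to `e^{-u}/2` over `h`,
-- leaving the other half for the root.
lemma exp_chainingLevel_mul (d : X → X → ℝ) (u : ℝ) (h : ℕ) :
    Real.exp (levelExponent d (h + 1)) * (2 * Real.exp (-chainingLevel d u h)) =
      Real.exp (-u) / 4 * (1 / 2) ^ h := by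
  have : -chainingLevel d u h = -u + -levelExponent d (h + 1) + -(((h + 1 : ℕ) : ℝ) * Real.log 2) +
      -Real.log 4 := by
    rw [chainingLevel]; push_cast; ring
  rw [this, Real.exp_add, Real.exp_add, Real.exp_add, Real.exp_neg (Real.log 4),
    Real.exp_log (by norm_num), Real.exp_neg (_ * _), Real.exp_nat_mul, Real.exp_log two_pos,
    Real.exp_neg (levelExponent d _)]
  have := (Real.exp_pos (levelExponent d (h + 1))).ne'
  rw [one_div_pow]
  field_simp
  ring

variable {κ : ℝ} {k : X → X → ℝ} {g : Fin N → X → Ω → ℝ}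

omit [Fintype X] [IsProbabilityMeasure P] in
lemma IsIIDGaussianProcess.integral_sq (hg : IsIIDGaussianProcess P g k) (hk : ∀ x, k x x = κ)
    (j : Fin N) (x : X) : ∫ ω, g j x ω ^ 2 ∂P = κ := by
  rw [← hg.variance_eq hk j x,
    variance_of_integral_eq_zero (hg.measurable j x).aemeasurable (hg.mean_zero j x)]

omit [Fintype X] in
-- Markov's inequality for `-f(x)`, whose mean is `N κ`; `κ + 1` keeps the threshold positive when
-- `κ = 0`.
lemma IsIIDGaussianProcess.measure_neg_objective_gt_le (hg : IsIIDGaussianProcess P g k)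
    (hk : ∀ x, k x x = κ) (hN : 1 ≤ N) (u : ℝ) (x : X) :
    P {ω | 2 * Real.exp u * (κ + 1) * N < -objective g x ω} ≤
      ENNReal.ofReal (Real.exp (-u) / 2) := by
  have hκ := hg.kernel_self_nonneg hk ⟨0, hN⟩ x
  have hN' : (0 : ℝ) < N := by exact_mod_cast hN
  have hint : ∀ j, Integrable (fun ω => g j x ω ^ 2) P := fun j => (hg.memLp j x).integrable_sq
  have hobj : (fun ω => -objective g x ω) = fun ω => ∑ j, g j x ω ^ 2 := by
    funext ω; simp [objective]
  have hnn : 0 ≤ᵐ[P] fun ω => -objective g x ω := by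
    rw [hobj]
    exact Filter.Eventually.of_forall fun ω => Finset.sum_nonneg fun j _ => sq_nonneg _
  have h1 := mul_meas_ge_le_integral_of_nonneg hnn
    (by rw [hobj]; exact integrable_finsetSum _ fun j _ => hint j)
    (2 * Real.exp u * (κ + 1) * N)
  have h2 : ∫ ω, -objective g x ω ∂P = N * κ := by
    rw [hobj, integral_finsetSum _ fun j _ => hint j]
    simp [hg.integral_sq hk]
  rw [h2] at h1
  have hc : 0 < 2 * Real.exp u * (κ + 1) * N := by positivity
  have h3 : P.real {ω | 2 * Real.exp u * (κ + 1) * N ≤ -objective g x ω} ≤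
      Real.exp (-u) / 2 := by
    refine le_of_mul_le_mul_left (h1.trans ?_) hc
    have : 2 * Real.exp u * (κ + 1) * N * (Real.exp (-u) / 2) =
        (Real.exp u * Real.exp (-u)) * ((κ + 1) * N) := by ring
    rw [this, ← Real.exp_add, add_neg_cancel, Real.exp_zero]
    nlinarith
  have h4 : P {ω | 2 * Real.exp u * (κ + 1) * N < -objective g x ω} ≤
      P {ω | 2 * Real.exp u * (κ + 1) * N ≤ -objective g x ω} :=
    measure_mono fun ω hω => by
      rw [Set.mem_ofPred_eq] at hω ⊢
      exact hω.le
  refine h4.trans ?_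
  rw [← ofReal_measureReal]
  exact ENNReal.ofReal_le_ofReal h3

theorem measure_not_chainingHolds_le [Nonempty X] (hg : IsIIDGaussianProcess P g k)
    (hk : ∀ x, k x x = κ) (hN : 1 ≤ N) (u : ℝ) (T : ChainingTree (dist κ k)) :
    P {ω | ¬ ChainingHolds (dist κ k) κ u g T ω} ≤ ENNReal.ofReal (Real.exp (-u)) := by
  have hf := hg.isSubGammaProcess hk hN
  let incr (h : ℕ) (s : X) : Set Ω :=
    {ω | 2 * √N * dist κ k s (T.parent h s) * (chainingLevel (dist κ k) u h + 1 / 4) <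
      |objective g s ω - objective g (T.parent h s) ω|}
  let zero : Set Ω := {ω | ¬ ∀ x y, dist κ k x y = 0 → objective g x ω = objective g y ω}
  let root (s : X) : Set Ω := {ω | 2 * Real.exp u * (κ + 1) * N < -objective g s ω}
  have hsub : {ω | ¬ ChainingHolds (dist κ k) κ u g T ω} ⊆
      (⋃ h, ⋃ s ∈ T.level (h + 1), incr h s) ∪ (zero ∪ ⋃ s ∈ T.level 0, root s) := by
    intro ω hω
    by_contra hcon
    simp only [Set.mem_union, Set.mem_iUnion, not_or, not_exists, incr, zero, root,
      Set.mem_ofPred_eq, not_lt, not_not] at hcon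
    exact hω ⟨hcon.1, hcon.2.1, hcon.2.2⟩
  have hzero : P zero = 0 := by
    have : ∀ᵐ ω ∂P, ∀ x y, dist κ k x y = 0 → objective g x ω = objective g y ω := by
      simp only [Filter.eventually_all]
      exact fun x y hxy => hf.ae_eq_of_dist_eq_zero hxy
    exact ae_iff.1 this
  have hroot : P (⋃ s ∈ T.level 0, root s) ≤ ENNReal.ofReal (Real.exp (-u) / 2) :=
    calc _ ≤ ∑ s ∈ T.level 0, P (root s) := measure_biUnion_finset_le _ _
      _ ≤ ∑ s ∈ T.level 0, ENNReal.ofReal (Real.exp (-u) / 2) :=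
        Finset.sum_le_sum fun s _ => hg.measure_neg_objective_gt_le hk hN u s
      _ = (T.level 0).card * ENNReal.ofReal (Real.exp (-u) / 2) := by simp
      _ ≤ 1 * ENNReal.ofReal (Real.exp (-u) / 2) := by
        gcongr
        exact_mod_cast T.card_level_zero_le
      _ = _ := one_mul _
  have hgeom : HasSum (fun h : ℕ => Real.exp (-u) / 4 * (1 / 2) ^ h) (Real.exp (-u) / 2) := by
    have := (hasSum_geometric_two).mul_left (Real.exp (-u) / 4)
    rwa [show Real.exp (-u) / 4 * 2 = Real.exp (-u) / 2 by ring] at this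
  have hincr : P (⋃ h, ⋃ s ∈ T.level (h + 1), incr h s) ≤ ENNReal.ofReal (Real.exp (-u) / 2) :=
    calc _ ≤ ∑' h, P (⋃ s ∈ T.level (h + 1), incr h s) := measure_iUnion_le _
      _ ≤ ∑' h : ℕ, ENNReal.ofReal (Real.exp (-u) / 4 * (1 / 2) ^ h) := by
        refine ENNReal.tsum_le_tsum fun h => ?_
        calc _ ≤ ∑ s ∈ T.level (h + 1), P (incr h s) := measure_biUnion_finset_le _ _
          _ ≤ ∑ s ∈ T.level (h + 1),
              ENNReal.ofReal (2 * Real.exp (-chainingLevel (dist κ k) u h)) :=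
            Finset.sum_le_sum fun s _ => hf.measure_abs_gt_le hN _ _ _
          _ = ENNReal.ofReal ((T.level (h + 1)).card *
              (2 * Real.exp (-chainingLevel (dist κ k) u h))) := by
            rw [Finset.sum_const, nsmul_eq_mul, ENNReal.ofReal_mul (Nat.cast_nonneg _),
              ENNReal.ofReal_natCast]
          _ ≤ _ := by
            refine ENNReal.ofReal_le_ofReal ?_
            rw [← exp_chainingLevel_mul]
            gcongr
            exact T.card_le _
      _ = _ := by
        rw [← ENNReal.ofReal_tsum_of_nonneg (fun h => by positivity) hgeom.summable, hgeom.tsum_eq]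
  calc _ ≤ P (⋃ h, ⋃ s ∈ T.level (h + 1), incr h s) + (P zero + P (⋃ s ∈ T.level 0, root s)) :=
        (measure_mono hsub).trans ((measure_union_le _ _).trans
          (add_le_add le_rfl (measure_union_le _ _)))
    _ ≤ ENNReal.ofReal (Real.exp (-u) / 2) + (0 + ENNReal.ofReal (Real.exp (-u) / 2)) := by
        gcongr
        exact hzero.le
    _ = _ := by
        rw [zero_add, ← ENNReal.ofReal_add (by positivity) (by positivity), add_halves]

end Chaining

/-! ### Bounds along the tree -/

/-- The sum of `(h' + 1) / 2 ^ h'` over `h' ≥ h`. -/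
def chainPotential (h : ℕ) : ℝ := (2 * h + 4) / 2 ^ h

lemma chainPotential_nonneg (h : ℕ) : 0 ≤ chainPotential h := by
  unfold chainPotential; positivity

lemma chainPotential_sub_succ (h : ℕ) :
    chainPotential h - chainPotential (h + 1) = (h + 1) / 2 ^ h := by
  unfold chainPotential
  rw [pow_succ]
  push_cast
  field_simp
  ring

section Tree

variable {X : Type*} {d : X → X → ℝ}

lemma ChainingTree.exists_level_abs_sub_le (T : ChainingTree d) {F : X → ℝ} {c : ℝ}
    (hF : ∀ h, ∀ s ∈ T.level (h + 1), |F s - F (T.parent h s)| ≤ c * ((h + 1) / 2 ^ h))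
    (n h : ℕ) : ∀ s ∈ T.level (h + n), ∃ s' ∈ T.level h,
      |F s - F s'| ≤ c * (chainPotential h - chainPotential (h + n)) := by
  induction n with
  | zero => exact fun s hs => ⟨s, hs, by simp⟩
  | succ n ih =>
    intro s hs
    obtain ⟨s', hs', h'⟩ := ih _ (T.parent_mem (h + n) s hs)
    refine ⟨s', hs', (abs_sub_le _ (F (T.parent (h + n) s)) _).trans
      ((add_le_add (hF (h + n) s hs) h').trans_eq ?_)⟩
    rw [← chainPotential_sub_succ, ← add_assoc]
    ring

/-- On a finite set `d(x, ·)` takes finitely many values, so a deep enough net contains a point at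
distance zero from `x`, where `F` agrees. The chain from there up to level `h` telescopes. -/
lemma ChainingTree.exists_level_abs_sub_le_chainPotential [Finite X] (T : ChainingTree d)
    (hd : ∀ x y, 0 ≤ d x y) {F : X → ℝ} {c : ℝ} (hc : 0 ≤ c)
    (hF : ∀ h, ∀ s ∈ T.level (h + 1), |F s - F (T.parent h s)| ≤ c * ((h + 1) / 2 ^ h))
    (h0 : ∀ x y, d x y = 0 → F x = F y) (x : X) (h : ℕ) :
    ∃ s ∈ T.level h, |F x - F s| ≤ c * chainPotential h := by
  have hlim : Filter.Tendsto (fun n => radius d (h + n)) Filter.atTop (nhds 0) := by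
    have h1 : Filter.Tendsto (fun n : ℕ => diameter d * (1 / 2 : ℝ) ^ n) Filter.atTop (nhds 0) := by
      simpa using (tendsto_pow_atTop_nhds_zero_of_lt_one (r := (1 / 2 : ℝ))
        (by norm_num) (by norm_num)).const_mul (diameter d)
    have h2 := (Filter.tendsto_add_atTop_iff_nat h).2 h1
    refine h2.congr fun n => ?_
    rw [radius, add_comm h n, one_div_pow, mul_one_div]
  have hev : ∀ᶠ n in Filter.atTop, ∀ s, 0 < d x s → radius d (h + n) < d x s := by
    rw [Filter.eventually_all]
    intro s
    rcases (hd x s).eq_or_lt with hs | hs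
    · exact Filter.Eventually.of_forall fun n hn => absurd hn (by rw [← hs]; exact lt_irrefl 0)
    · filter_upwards [hlim.eventually_lt_const hs] with n hn _ using hn
  obtain ⟨n, hn⟩ := hev.exists
  obtain ⟨s, hs, hxs⟩ := T.isNet (h + n) x
  have hzero : d x s = 0 := by
    by_contra hne
    exact absurd hxs (not_le.2 (hn s (lt_of_le_of_ne (hd x s) (Ne.symm hne))))
  obtain ⟨s', hs', h'⟩ := T.exists_level_abs_sub_le hF n h s hs
  refine ⟨s', hs', ?_⟩
  rw [h0 x s hzero]
  refine h'.trans ?_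
  gcongr
  linarith [chainPotential_nonneg (h + n)]

/-- The positive part of `log (R / Δ)`. -/
def logRatio (d : X → X → ℝ) (R : ℝ) : ℝ := max 0 (Real.log (R / diameter d))

lemma logRatio_nonneg (d : X → X → ℝ) (R : ℝ) : 0 ≤ logRatio d R := le_max_left _ _

lemma coveringNumber_anti [Fintype X] (hd : ∀ x, d x x = 0) {ε ε' : ℝ} (hε : 0 ≤ ε)
    (h : ε ≤ ε') : coveringNumber d ε' ≤ coveringNumber d ε := by
  obtain ⟨S, hS, hcard⟩ := Nat.sInf_mem (s := {n : ℕ | ∃ S : Finset X, IsNet d ε S ∧ S.card = n})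
    ⟨_, Finset.univ, fun x => ⟨x, Finset.mem_univ x, by rw [hd]; exact hε⟩, rfl⟩
  rw [coveringNumber, coveringNumber, ← hcard]
  refine coveringNumber_le_card fun x => ?_
  obtain ⟨s, hs, hxs⟩ := hS x
  exact ⟨s, hs, hxs.trans h⟩

lemma levelExponent_le [Fintype X] (hd : ∀ x, d x x = 0) {R D : ℝ} (hR : 0 < R) (hD : 0 ≤ D)
    (hcov : ∀ ε : ℝ, 0 < ε → ε ≤ R → (coveringNumber d ε : ℝ) ≤ (R / ε) ^ D)
    (hΔ : 0 < diameter d) (h : ℕ) :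
    levelExponent d h ≤ 2 * D * (logRatio d R + h * Real.log 2) := by
  have hlog2 := Real.log_pos one_lt_two
  have hL := logRatio_nonneg d R
  have hε : 0 < radius d h := by unfold radius; positivity
  rw [levelExponent, mul_assoc]
  refine mul_le_mul_of_nonneg_left ?_ zero_le_two
  rcases Nat.eq_zero_or_pos (coveringNumber d (radius d h)) with h0 | h0
  · rw [h0, Nat.cast_zero, Real.log_zero]
    positivity
  rcases le_total (radius d h) R with hle | hle
  · refine (Real.log_le_log (by exact_mod_cast h0) (hcov _ hε hle)).trans ?_
    rw [Real.log_rpow (by positivity)]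
    refine mul_le_mul_of_nonneg_left ?_ hD
    have : R / radius d h = R / diameter d * 2 ^ h := by
      rw [radius]; field_simp
    rw [this, Real.log_mul (by positivity) (by positivity), Real.log_pow]
    gcongr
    exact le_max_right _ _
  -- Beyond `R` the covering hypothesis is silent, but at `ε = R` it already forces one ball.
  · have h1 : (coveringNumber d (radius d h) : ℝ) ≤ 1 := by
      refine le_trans (by exact_mod_cast coveringNumber_anti hd hR.le hle)
        ((hcov R hR le_rfl).trans_eq ?_)
      rw [div_self hR.ne', Real.one_rpow]
    refine (Real.log_nonpos (Nat.cast_nonneg _) h1).trans ?_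
    positivity

/-- The product `(1 + log⁺(R/Δ))(h + 1)` dominates both summands, which separates the dependence on
`Δ` from that on the depth; the 3 absorbs `log 2`, `log 4` and `1/4`. -/
lemma chainingLevel_add_le [Fintype X] (hd : ∀ x, d x x = 0) {R D u : ℝ} (hR : 0 < R) (hD : 0 ≤ D)
    (hu : 0 ≤ u) (hcov : ∀ ε : ℝ, 0 < ε → ε ≤ R → (coveringNumber d ε : ℝ) ≤ (R / ε) ^ D)
    (hΔ : 0 < diameter d) (h : ℕ) :
    chainingLevel d u h + 1 / 4 ≤ (u + 2 * D + 3) * (1 + logRatio d R) * (h + 1) := by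
  have h1 := levelExponent_le hd hR hD hcov hΔ (h + 1)
  have hL := logRatio_nonneg d R
  have hlog2 : Real.log 2 ≤ 0.7 := Real.log_two_lt_d9.le.trans (by norm_num)
  have hlog2' := Real.log_pos one_lt_two
  have hlog4 : Real.log 4 ≤ 1.4 := by
    rw [show (4 : ℝ) = 2 ^ 2 by norm_num, Real.log_pow]
    push_cast
    linarith
  have hh : (0 : ℝ) ≤ h := Nat.cast_nonneg h
  obtain ⟨L, hLdef⟩ : ∃ L, L = logRatio d R := ⟨_, rfl⟩
  rw [← hLdef] at h1 hL ⊢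
  push_cast at h1
  have e1 : ((h : ℝ) + 1) * Real.log 2 ≤ 0.7 * (h + 1) := by nlinarith
  have e2 : 2 * D * (L + (h + 1) * Real.log 2) ≤ 2 * D * ((1 + L) * (h + 1)) := by
    refine mul_le_mul_of_nonneg_left ?_ (by positivity)
    nlinarith [mul_nonneg hL hh]
  have e3 : 1 ≤ (1 + L) * (h + 1) := by nlinarith [mul_nonneg hL hh]
  have e4 : (h : ℝ) + 1 ≤ (1 + L) * (h + 1) := by nlinarith [mul_nonneg hL hh]
  have e5 : u ≤ u * ((1 + L) * (h + 1)) := le_mul_of_one_le_right hu e3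
  rw [chainingLevel]
  nlinarith

/-- The factor in front of the chaining potential. -/
def chainConstant (d : X → X → ℝ) (N : ℕ) (u D R : ℝ) : ℝ :=
  2 * √N * diameter d * ((u + 2 * D + 3) * (1 + logRatio d R))

lemma exists_level_abs_objective_sub_le {Ω : Type*} {N : ℕ} {g : Fin N → X → Ω → ℝ}
    {T : ChainingTree d} {ω : Ω} [Fintype X] {κ u : ℝ} (hω : ChainingHolds d κ u g T ω)
    (hd : ∀ x, d x x = 0) (hd0 : ∀ x y, 0 ≤ d x y) {R D : ℝ} (hR : 0 < R) (hD : 0 ≤ D)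
    (hu : 0 ≤ u) (hcov : ∀ ε : ℝ, 0 < ε → ε ≤ R → (coveringNumber d ε : ℝ) ≤ (R / ε) ^ D)
    (hΔ : 0 < diameter d) (x : X) (h : ℕ) :
    ∃ s ∈ T.level h, |objective g x ω - objective g s ω| ≤
      chainConstant d N u D R * chainPotential h := by
  have hL := logRatio_nonneg d R
  refine T.exists_level_abs_sub_le_chainPotential (F := fun x => objective g x ω) hd0
    (by unfold chainConstant; positivity) (fun h s hs => ?_) hω.eq_of_dist_eq_zero x h
  have h2 := T.dist_parent_le hs
  have h3 := hd0 s (T.parent h s)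
  calc _ ≤ 2 * √N * d s (T.parent h s) * (chainingLevel d u h + 1 / 4) := hω.increment h s hs
    _ ≤ 2 * √N * d s (T.parent h s) * ((u + 2 * D + 3) * (1 + logRatio d R) * (h + 1)) := by
      refine mul_le_mul_of_nonneg_left (chainingLevel_add_le hd hR hD hu hcov hΔ h) (by positivity)
    _ ≤ 2 * √N * radius d h * ((u + 2 * D + 3) * (1 + logRatio d R) * (h + 1)) := by gcongr
    _ = _ := by
      rw [radius, chainConstant]
      ring

end Tree

/-! ### Instantaneous regret -/

/-- Since `|m| - w ≥ |x| - 2w`, the loss is linear in `w` with factor `|x|`: no `w²` term remains.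
-/
lemma sq_sub_sq_lower_le {x m w : ℝ} (h : |x - m| ≤ w) :
    x ^ 2 - (max 0 (|m| - w)) ^ 2 ≤ 4 * w * |x| := by
  have hw : 0 ≤ w := (abs_nonneg _).trans h
  have h1 : |x| - |m| ≤ w := (abs_sub_abs_le_abs_sub x m).trans h
  have h2 : max 0 (|x| - 2 * w) ≤ max 0 (|m| - w) := max_le_max le_rfl (by linarith)
  have h3 : (max 0 (|x| - 2 * w)) ^ 2 ≤ (max 0 (|m| - w)) ^ 2 :=
    pow_le_pow_left₀ (le_max_left _ _) h2 2
  have hx := abs_nonneg x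
  have h4 : |x| ^ 2 ≤ (max 0 (|x| - 2 * w)) ^ 2 + 4 * w * |x| := by
    rcases le_total 0 (|x| - 2 * w) with h5 | h5
    · rw [max_eq_right h5]; nlinarith
    · rw [max_eq_left h5]; nlinarith
  rw [sq_abs] at h4
  linarith

lemma sq_lower_le_sq {x m w : ℝ} (h : |x - m| ≤ w) : (max 0 (|m| - w)) ^ 2 ≤ x ^ 2 := by
  have h1 : |m| - |x| ≤ w := by
    have := abs_sub_abs_le_abs_sub m x
    rw [abs_sub_comm] at this
    exact this.trans h
  rw [← sq_abs x]
  exact pow_le_pow_left₀ (le_max_left _ _) (max_le (abs_nonneg x) (by linarith)) 2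

section Instant

variable {Ω X : Type*} {N : ℕ} {k d : X → X → ℝ} {g : Fin N → X → Ω → ℝ}
  {noise : ℕ → Fin N → Ω → ℝ} {η u a : ℝ} {q : ℕ → Ω → X} {T : ChainingTree d} {ω : Ω}

lemma sum_abs_le_sqrt_neg_objective (g : Fin N → X → Ω → ℝ) (x : X) (ω : Ω) :
    ∑ j, |g j x ω| ≤ √N * √(-objective g x ω) := by
  have h := sq_sum_le_card_mul_sum_sq (s := Finset.univ) (f := fun j => |g j x ω|)
  rw [← Real.sqrt_mul (Nat.cast_nonneg N)]
  refine Real.le_sqrt_of_sq_le (h.trans_eq ?_)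
  simp [objective]

/-- Optimism: `f(s) ≤ U(s) ≤ U(q)`, and `U(q) - f(q)` is controlled by the interval widths at the
query alone. -/
lemma objective_sub_query_le [Fintype X] (hc : ConfidenceHolds k η u a g noise T q ω) {m : ℕ}
    (hmem : q m ω ∈ T.level (depth (m + 1)))
    (hmax : ∀ x ∈ T.level (depth (m + 1)),
      upperBound k η (observation g noise q) q m (confidenceLevel d u a (m + 1)) x ω ≤
        upperBound k η (observation g noise q) q m (confidenceLevel d u a (m + 1)) (q m ω) ω)
    {s : X} (hs : s ∈ T.level (depth (m + 1))) :
    objective g s ω - objective g (q m ω) ω ≤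
      4 * confidenceFactor N (confidenceLevel d u a (m + 1)) *
        posteriorSD k η (fun l : Fin m => q l ω) (q m ω) * (√N * √(-objective g (q m ω) ω)) := by
  have h1 : objective g s ω ≤
      upperBound k η (observation g noise q) q m (confidenceLevel d u a (m + 1)) s ω :=
    neg_le_neg (Finset.sum_le_sum fun j _ => sq_lower_le_sq (hc m s hs j))
  have h2 : upperBound k η (observation g noise q) q m (confidenceLevel d u a (m + 1)) (q m ω) ω -
      objective g (q m ω) ω ≤ ∑ j, 4 * (confidenceFactor N (confidenceLevel d u a (m + 1)) *
        posteriorSD k η (fun l : Fin m => q l ω) (q m ω)) * |g j (q m ω) ω| := by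
    rw [upperBound, objective, neg_sub_neg, ← Finset.sum_sub_distrib]
    exact Finset.sum_le_sum fun j _ => sq_sub_sq_lower_le (hc m _ hmem j)
  have h3 : 0 ≤ 4 * (confidenceFactor N (confidenceLevel d u a (m + 1)) *
        posteriorSD k η (fun l : Fin m => q l ω) (q m ω)) := by
    unfold confidenceFactor posteriorSD; positivity
  rw [← Finset.mul_sum] at h2
  have h4 := mul_le_mul_of_nonneg_left (sum_abs_le_sqrt_neg_objective g (q m ω) ω) h3
  linarith [hmax s hs]

lemma regret_eq_sum [Finite X] [Nonempty X] (f : X → Ω → ℝ) (q : ℕ → Ω → X) (t : ℕ) (ω : Ω) :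
    ∃ x, regret f q t ω = ∑ m ∈ Finset.range t, (f x ω - f (q m ω) ω) := by
  obtain ⟨x, hx⟩ := exists_eq_ciSup_of_finite (f := fun x => f x ω)
  refine ⟨x, ?_⟩
  simp [regret, ← hx]

end Instant

/-! ### Elementary estimates -/

lemma depth_le (i : ℕ) (hi : 1 ≤ i) : (depth i : ℝ) ≤ 1 / 2 * Real.logb 2 i + 1 :=
  (Nat.ceil_lt_add_one (mul_nonneg (by norm_num)
    (Real.logb_nonneg one_lt_two (by exact_mod_cast hi)))).le

lemma sqrt_le_two_pow_depth {i : ℕ} (hi : 1 ≤ i) : √(i : ℝ) ≤ 2 ^ depth i := by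
  have hi' : (0 : ℝ) < i := by exact_mod_cast hi
  have h : 1 / 2 * Real.logb 2 i ≤ depth i := Nat.le_ceil _
  calc √(i : ℝ) = ((2 : ℝ) ^ Real.logb 2 i) ^ (1 / 2 : ℝ) := by
        rw [Real.rpow_logb two_pos (by norm_num) hi', Real.sqrt_eq_rpow]
    _ = (2 : ℝ) ^ (1 / 2 * Real.logb 2 i) := by
        rw [← Real.rpow_mul zero_le_two, mul_comm]
    _ ≤ (2 : ℝ) ^ (depth i : ℝ) := Real.rpow_le_rpow_of_exponent_le one_le_two h
    _ = _ := Real.rpow_natCast _ _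

lemma log_two_le_log {t : ℕ} (ht : 2 ≤ t) : Real.log 2 ≤ Real.log t :=
  Real.log_le_log two_pos (by exact_mod_cast ht)

lemma chainPotential_depth_le {i t : ℕ} (hi : 1 ≤ i) (hit : i ≤ t) (ht : 2 ≤ t) :
    chainPotential (depth i) ≤ 7 / Real.log 2 * Real.log t * (1 / √(i : ℝ)) := by
  have hlog2 := Real.log_pos one_lt_two
  have hi' : (0 : ℝ) < i := by exact_mod_cast hi
  have h1 := depth_le i hi
  have h2 : Real.log i ≤ Real.log t := Real.log_le_log hi' (by exact_mod_cast hit)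
  have h3 := log_two_le_log ht
  -- The ceiling gives `2h(i) + 4 ≤ log₂ i + 6`, and `log₂ t ≥ 1` turns this into `7 log₂ t`.
  have h4 : 2 * (depth i : ℝ) + 4 ≤ 7 / Real.log 2 * Real.log t := by
    have h5 : Real.logb 2 i ≤ Real.log t / Real.log 2 := by
      rw [Real.logb]; gcongr
    have h6 : 1 ≤ Real.log t / Real.log 2 := (one_le_div hlog2).2 h3
    have h7 : 7 / Real.log 2 * Real.log t = 7 * (Real.log t / Real.log 2) := by ring
    rw [h7]
    linarith
  rw [chainPotential, mul_one_div]
  exact div_le_div₀ (by positivity) h4 (Real.sqrt_pos.2 hi') (sqrt_le_two_pow_depth hi)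

lemma sum_one_div_sqrt_le (t : ℕ) :
    ∑ m ∈ Finset.range t, 1 / √((m + 1 : ℕ) : ℝ) ≤ 2 * √(t : ℝ) := by
  induction t with
  | zero => simp
  | succ t ih =>
    rw [Finset.sum_range_succ]
    have ht : (0 : ℝ) ≤ t := Nat.cast_nonneg t
    have hp : 0 < √((t + 1 : ℕ) : ℝ) := Real.sqrt_pos.2 (by positivity)
    have h1 : √((t + 1 : ℕ) : ℝ) ^ 2 = t + 1 := by
      rw [Real.sq_sqrt (by positivity)]; push_cast; ring
    have h2 : √(t : ℝ) ^ 2 = t := Real.sq_sqrt ht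
    have h3 : 1 / √((t + 1 : ℕ) : ℝ) ≤ 2 * √((t + 1 : ℕ) : ℝ) - 2 * √(t : ℝ) := by
      rw [div_le_iff₀ hp]
      -- With `p = √(t+1)` and `s = √t`: `1 = p² - s² ≤ 2p(p - s)`.
      nlinarith [sq_nonneg (√((t + 1 : ℕ) : ℝ) - √(t : ℝ))]
    linarith

/-- The regret bound in the regime `t ≤ N`. -/
lemma regret_bound_of_le_card {N t : ℕ} {r c W γ γ₀ : ℝ} (hr : r ≤ t * (8 * c))
    (hc : c ≤ W * √N) (hW : 0 ≤ W) (ht : 1 ≤ t) (htN : t ≤ N) (hγ₀ : 0 < γ₀) (hγ : γ₀ ≤ γ) :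
    r ≤ 8 * W / min γ₀ √(γ₀ * Real.log 2) * (N * (√(t * γ * Real.log t) + γ)) := by
  have hlog2 := Real.log_pos one_lt_two
  have hmin : 0 < min γ₀ √(γ₀ * Real.log 2) := lt_min hγ₀ (Real.sqrt_pos.2 (by positivity))
  have htN' : √(t : ℝ) ≤ √(N : ℝ) := Real.sqrt_le_sqrt (by exact_mod_cast htN)
  have h1 : (t : ℝ) * √N ≤ N * √t := by
    have e1 : √(t : ℝ) * √t = t := Real.mul_self_sqrt (Nat.cast_nonneg t)
    have e2 : √(N : ℝ) * √N = N := Real.mul_self_sqrt (Nat.cast_nonneg N)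
    calc (t : ℝ) * √N = √t * √N * √t := by linear_combination -√(N : ℝ) * e1
      _ ≤ √N * √N * √t := by gcongr
      _ = _ := by rw [e2]
  -- At `t = 1` the logarithm vanishes and `γ ≥ γ₀` carries the bound; for `t ≥ 2` the square root
  -- does.
  have h2 : min γ₀ √(γ₀ * Real.log 2) * √t ≤ √(t * γ * Real.log t) + γ := by
    rcases ht.eq_or_lt with h | h
    · subst h
      simp only [Nat.cast_one, Real.sqrt_one, Real.log_one, mul_zero, Real.sqrt_zero, zero_add,
        mul_one]
      exact (min_le_left _ _).trans hγ
    · have h3 := log_two_le_log h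
      have hγ1 : 0 ≤ γ := hγ₀.le.trans hγ
      calc min γ₀ √(γ₀ * Real.log 2) * √t ≤ √(γ₀ * Real.log 2) * √t := by
            gcongr; exact min_le_right _ _
        _ = √(t * γ₀ * Real.log 2) := by
            rw [← Real.sqrt_mul (by positivity)]; ring_nf
        _ ≤ √(t * γ * Real.log t) := by gcongr
        _ ≤ _ := by linarith
  calc r ≤ t * (8 * (W * √N)) := hr.trans (by gcongr)
    _ = 8 * W * (t * √N) := by ring
    _ ≤ 8 * W * (N * √t) := by gcongr
    _ = 8 * W / min γ₀ √(γ₀ * Real.log 2) * (N * (min γ₀ √(γ₀ * Real.log 2) * √t)) := by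
        field_simp
    _ ≤ _ := by gcongr

/-- The regret bound in the regime where the diameter is small compared with `1 / t`. -/
lemma regret_bound_of_small {N t : ℕ} {r c W : ℝ} (hr : r ≤ t * (8 * c))
    (hc : c ≤ W * √N * (1 / √t)) (hW : 0 ≤ W) (ht : 2 ≤ t) :
    r ≤ 8 * W / Real.log 2 * (√(N * t) * Real.log t) := by
  have hlog2 := Real.log_pos one_lt_two
  have h3 := log_two_le_log ht
  have hp : 0 < √(t : ℝ) := Real.sqrt_pos.2 (by positivity)
  have e1 : √(t : ℝ) ^ 2 = t := Real.sq_sqrt (Nat.cast_nonneg t)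
  have e2 : (t : ℝ) * (1 / √t) = √t := by
    field_simp
    exact e1.symm
  calc r ≤ t * (8 * (W * √N * (1 / √t))) := hr.trans (by gcongr)
    _ = 8 * W * (√N * (t * (1 / √t))) := by ring
    _ = 8 * W * √(N * t) := by rw [e2, Real.sqrt_mul (Nat.cast_nonneg N)]
    _ = 8 * W / Real.log 2 * (√(N * t) * Real.log 2) := by field_simp
    _ ≤ _ := by gcongr

/-- The regret bound in the main regime. -/
lemma regret_bound_of_large {N t : ℕ} {r c W B S b γ : ℝ} {β σ : ℕ → ℝ}
    (hr : r ≤ ∑ m ∈ Finset.range t, (c * chainPotential (depth (m + 1)) +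
      4 * β m * σ m * (√N * √(B * N))))
    (hc : c ≤ W * √N) (hW : 0 ≤ W) (ht : 2 ≤ t) (hB : 0 ≤ B) (hb : 0 ≤ b) (hS : 0 ≤ S)
    (hγ : 0 ≤ γ) (hσ0 : ∀ m, 0 ≤ σ m)
    (hβ : ∀ m < t, β m ≤ √(b * Real.log t)) (hσ : ∑ m ∈ Finset.range t, σ m ^ 2 ≤ S * γ) :
    r ≤ 14 * W / Real.log 2 * (√(N * t) * Real.log t) +
      4 * √B * √b * √S * (N * √(t * γ * Real.log t)) := by
  have hlog2 := Real.log_pos one_lt_two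
  have hlogt := log_two_le_log ht
  have hlogt0 : 0 ≤ Real.log t := hlog2.le.trans hlogt
  have h1 : ∑ m ∈ Finset.range t, c * chainPotential (depth (m + 1)) ≤
      14 * W / Real.log 2 * (√(N * t) * Real.log t) :=
    calc _ ≤ ∑ m ∈ Finset.range t, W * √N *
          (7 / Real.log 2 * Real.log t * (1 / √((m + 1 : ℕ) : ℝ))) := by
          refine Finset.sum_le_sum fun m hm => mul_le_mul hc ?_ (chainPotential_nonneg _)
            (by positivity)
          exact chainPotential_depth_le (Nat.le_add_left 1 m) (Finset.mem_range.1 hm) ht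
      _ = W * √N * (7 / Real.log 2 * Real.log t) *
          ∑ m ∈ Finset.range t, 1 / √((m + 1 : ℕ) : ℝ) := by
          rw [Finset.mul_sum]
          exact Finset.sum_congr rfl fun m _ => by ring
      _ ≤ W * √N * (7 / Real.log 2 * Real.log t) * (2 * √t) := by
          gcongr
          exact sum_one_div_sqrt_le t
      _ = _ := by
          rw [Real.sqrt_mul (Nat.cast_nonneg N)]
          ring
  have hσsum : ∑ m ∈ Finset.range t, σ m ≤ √(t * (S * γ)) := by
    refine Real.le_sqrt_of_sq_le ?_
    have := sq_sum_le_card_mul_sum_sq (s := Finset.range t) (f := σ)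
    rw [Finset.card_range] at this
    exact this.trans (by gcongr)
  have h2 : ∑ m ∈ Finset.range t, 4 * β m * σ m * (√N * √(B * N)) ≤
      4 * √B * √b * √S * (N * √(t * γ * Real.log t)) :=
    calc _ ≤ ∑ m ∈ Finset.range t, 4 * √(b * Real.log t) * σ m * (√N * √(B * N)) := by
          refine Finset.sum_le_sum fun m hm => ?_
          have := hβ m (Finset.mem_range.1 hm)
          have := hσ0 m
          gcongr
      _ = 4 * √(b * Real.log t) * (√N * √(B * N)) * ∑ m ∈ Finset.range t, σ m := by
          rw [Finset.mul_sum]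
          exact Finset.sum_congr rfl fun m _ => by ring
      _ ≤ 4 * √(b * Real.log t) * (√N * √(B * N)) * √(t * (S * γ)) := by gcongr
      _ = 4 * √B * √b * √S * ((√N * √N) * (√t * √γ * √(Real.log t))) := by
          rw [Real.sqrt_mul hb, Real.sqrt_mul hB, Real.sqrt_mul (Nat.cast_nonneg t),
            Real.sqrt_mul hS]
          ring
      _ = _ := by
          rw [Real.mul_self_sqrt (Nat.cast_nonneg N), ← Real.sqrt_mul (Nat.cast_nonneg t),
            ← Real.sqrt_mul (by positivity)]
  rw [Finset.sum_add_distrib] at hr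
  linarith

/-! ### The regret bound -/

section Deterministic

variable {Ω X : Type*} {N : ℕ} {d : X → X → ℝ} {g : Fin N → X → Ω → ℝ} {κ u D R : ℝ}
  {T : ChainingTree d} {ω : Ω}

/-- `log s ≤ s` keeps `Δ log(R/Δ)` bounded by `R`, so the chaining factor is uniform over all
spaces. -/
lemma diameter_mul_one_add_logRatio_le (hR : 0 < R) (hΔ : 0 < diameter d) :
    diameter d * (1 + logRatio d R) ≤ diameter d + R := by
  have h : logRatio d R ≤ R / diameter d :=
    max_le (by positivity) (Real.log_le_self (by positivity))
  calc _ ≤ diameter d * (1 + R / diameter d) := by gcongr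
    _ = _ := by field_simp

/-- Here `log s ≤ 2√s` gives `Δ log(R/Δ) ≤ 2√(RΔ)`, so the crude bound of order `t √N / √t` matches
the target `√(Nt)`. -/
lemma diameter_mul_one_add_logRatio_le_of_le (hR : 0 < R) (hΔ : 0 < diameter d) {t : ℕ}
    (ht : 1 ≤ t) (h : diameter d ≤ 1 / t) :
    diameter d * (1 + logRatio d R) ≤ (1 + 2 * √R) * (1 / √t) := by
  have ht' : (0 : ℝ) < t := by exact_mod_cast ht
  have hlog : Real.log (R / diameter d) ≤ 2 * √(R / diameter d) := by
    have h1 := Real.log_le_self (Real.sqrt_nonneg (R / diameter d))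
    rw [Real.log_sqrt (by positivity)] at h1
    linarith
  have hL : logRatio d R ≤ 2 * √(R / diameter d) := max_le (by positivity) hlog
  have h2 : diameter d * √(R / diameter d) = √R * √(diameter d) := by
    have e : √(diameter d) * √(diameter d) = diameter d := Real.mul_self_sqrt hΔ.le
    have hp := Real.sqrt_pos.2 hΔ
    rw [Real.sqrt_div hR.le]
    field_simp
    rw [sq, e]
  have h3 : √(diameter d) ≤ 1 / √t := by
    rw [one_div, ← Real.sqrt_inv, ← one_div]
    exact Real.sqrt_le_sqrt h
  have h4 : diameter d ≤ 1 / √t := by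
    refine h.trans (one_div_le_one_div_of_le (Real.sqrt_pos.2 ht') ?_)
    rw [Real.sqrt_le_left ht'.le]
    have : (1 : ℝ) ≤ t := by exact_mod_cast ht
    nlinarith
  calc _ ≤ diameter d * (1 + 2 * √(R / diameter d)) := by gcongr
    _ = diameter d + 2 * (diameter d * √(R / diameter d)) := by ring
    _ = diameter d + 2 * (√R * √(diameter d)) := by rw [h2]
    _ ≤ 1 / √t + 2 * (√R * (1 / √t)) := by gcongr
    _ = _ := by ring

lemma logRatio_le_of_lt (hR : 0 < R) {t : ℕ} (ht : 1 ≤ t) (h : 1 / t < diameter d) :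
    logRatio d R ≤ |Real.log R| + Real.log t := by
  have ht' : (0 : ℝ) < t := by exact_mod_cast ht
  have hΔ : 0 < diameter d := lt_trans (by positivity) h
  have hlogt : 0 ≤ Real.log t := Real.log_natCast_nonneg t
  refine max_le (by positivity) ?_
  rw [Real.log_div hR.ne' hΔ.ne']
  have h1 : -Real.log t ≤ Real.log (diameter d) := by
    rw [← Real.log_inv, ← one_div]
    exact Real.log_le_log (by positivity) h.le
  linarith [le_abs_self (Real.log R)]

variable [Fintype X]

/-- The bounds on the values of the objective on the event `ChainingHolds`. -/
lemma objective_sub_le_and_neg_le [Nonempty X] (hω : ChainingHolds d κ u g T ω)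
    (hd : ∀ x, d x x = 0) (hd0 : ∀ x y, 0 ≤ d x y) (hR : 0 < R) (hD : 0 ≤ D)
    (hu : 0 ≤ u) (hcov : ∀ ε : ℝ, 0 < ε → ε ≤ R → (coveringNumber d ε : ℝ) ≤ (R / ε) ^ D)
    (hΔ : 0 < diameter d) :
    (∀ x y, objective g x ω - objective g y ω ≤ 8 * chainConstant d N u D R) ∧
    ∀ x, -objective g x ω ≤ 2 * Real.exp u * (κ + 1) * N + 4 * chainConstant d N u D R := by
  -- Every value lies within `4c` of the value at the single root: hence `8c` for differences and
  -- `4c` added to the root bound.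
  have h4 : chainPotential 0 = 4 := by norm_num [chainPotential]
  have key := fun x => exists_level_abs_objective_sub_le hω hd hd0 hR hD hu hcov hΔ x 0
  simp only [h4] at key
  refine ⟨fun x y => ?_, fun x => ?_⟩
  · obtain ⟨s, hs, hxs⟩ := key x
    obtain ⟨s', hs', hys⟩ := key y
    have : s = s' := Finset.card_le_one.1 T.card_level_zero_le s hs s' hs'
    subst this
    linarith [abs_le.1 hxs, abs_le.1 hys]
  · obtain ⟨s, hs, hxs⟩ := key x
    linarith [abs_le.1 hxs, hω.root s hs]

/-- The conditions `N ≤ t` and `1/t < Δ` turn `log N` and `log(R/Δ)` into multiples of `log t` plus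
constants; division by `log 2` absorbs the constants since `t ≥ 2`. -/
lemma confidence_sq_le (hd : ∀ x, d x x = 0) (hR : 0 < R) (hD : 0 ≤ D) {a : ℝ} (ha : 1 < a)
    (hu : 0 ≤ u) (hcov : ∀ ε : ℝ, 0 < ε → ε ≤ R → (coveringNumber d ε : ℝ) ≤ (R / ε) ^ D)
    {i t : ℕ} (hi : 1 ≤ i) (hit : i ≤ t) (ht : 2 ≤ t) (hN : 1 ≤ N) (hNt : N ≤ t)
    (h : 1 / t < diameter d) :
    2 * (confidenceLevel d u a i + Real.log N) ≤
      (2 * (u + 2 * D * |Real.log R| + Real.log (riemannZeta (a : ℂ)).re) / Real.log 2 +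
        2 * (6 * D + a + 1)) * Real.log t := by
  have hlog2 := Real.log_pos one_lt_two
  have hlogt := log_two_le_log ht
  have hi' : (0 : ℝ) < i := by exact_mod_cast hi
  have ht1 : 1 ≤ t := hi.trans hit
  have hΔ : 0 < diameter d := lt_trans (by positivity) h
  have hz := one_le_zeta_re ha
  have hlogz : 0 ≤ Real.log (riemannZeta (a : ℂ)).re := Real.log_nonneg hz
  have hlogi : Real.log i ≤ Real.log t := Real.log_le_log hi' (by exact_mod_cast hit)
  have hlogN : Real.log N ≤ Real.log t :=
    Real.log_le_log (by exact_mod_cast hN) (by exact_mod_cast hNt)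
  have h1 : levelExponent d (depth i) ≤ 2 * D * (|Real.log R| + 3 * Real.log t) := by
    refine (levelExponent_le hd hR hD hcov hΔ _).trans
      (mul_le_mul_of_nonneg_left ?_ (by positivity))
    have e1 := logRatio_le_of_lt hR ht1 h
    have e2 : (depth i : ℝ) * Real.log 2 ≤ (1 / 2 * Real.logb 2 i + 1) * Real.log 2 :=
      mul_le_mul_of_nonneg_right (depth_le i hi) hlog2.le
    have e3 : Real.logb 2 i * Real.log 2 = Real.log i := by
      rw [Real.logb]; field_simp
    have e4 : (1 / 2 * Real.logb 2 i + 1) * Real.log 2 = 1 / 2 * Real.log i + Real.log 2 := by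
      rw [← e3]; ring
    linarith
  have h2 : Real.log ((i : ℝ) ^ a * (riemannZeta (a : ℂ)).re) ≤
      a * Real.log t + Real.log (riemannZeta (a : ℂ)).re := by
    rw [Real.log_mul (by positivity) (by linarith), Real.log_rpow hi']
    have : a * Real.log i ≤ a * Real.log t := by gcongr
    linarith
  have h3 : 2 * (u + 2 * D * |Real.log R| + Real.log (riemannZeta (a : ℂ)).re) ≤
      2 * (u + 2 * D * |Real.log R| + Real.log (riemannZeta (a : ℂ)).re) / Real.log 2 *
        Real.log t := by
    rw [div_mul_eq_mul_div, le_div_iff₀ hlog2]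
    gcongr
  rw [confidenceLevel, add_mul]
  linarith

end Deterministic

/-- The constant of the regret bound. -/
def regretConstant (a u D R κ η : ℝ) : ℝ :=
  let K := u + 2 * D + 3
  let W := 2 * K * (2 * κ + R)
  let γ₀ := 1 / 2 * Real.log (1 + κ / η ^ 2)
  let b := 2 * (u + 2 * D * |Real.log R| + Real.log (riemannZeta (a : ℂ)).re) / Real.log 2 +
    2 * (6 * D + a + 1)
  8 * W / min γ₀ √(γ₀ * Real.log 2) + 8 * (2 * K * (1 + 2 * √R)) / Real.log 2 +
    14 * W / Real.log 2 +
    4 * √(2 * Real.exp u * (κ + 1) + 4 * W) * √b * √(2 * (η ^ 2 + κ))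

/-! ### The regret on the intersection of the two good events. -/

section Regret

variable {Ω X : Type*} [MeasurableSpace Ω] {P : Measure Ω} [IsProbabilityMeasure P] [Fintype X]
  [Nonempty X] {N : ℕ} {k : X → X → ℝ} {g : Fin N → X → Ω → ℝ} {noise : ℕ → Fin N → Ω → ℝ}
  {a u D R κ η : ℝ} {T : ChainingTree (dist κ k)} {q : ℕ → Ω → X} {ω : Ω}

omit [MeasurableSpace Ω] in
lemma regret_nonpos_of_diameter_eq_zero (hω : ChainingHolds (dist κ k) κ u g T ω)
    (hd0 : ∀ x y, 0 ≤ dist κ k x y) (hΔ : diameter (dist κ k) ≤ 0) (t : ℕ) :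
    regret (objective g) q t ω ≤ 0 := by
  obtain ⟨x, hx⟩ := regret_eq_sum (objective g) q t ω
  rw [hx]
  refine Finset.sum_nonpos fun m _ => ?_
  rw [hω.eq_of_dist_eq_zero x (q m ω) (le_antisymm ((le_diameter _ _).trans hΔ) (hd0 _ _)),
    sub_self]

omit [Fintype X] in
lemma diameter_dist_le (hκ : 0 ≤ κ) (k : X → X → ℝ) : diameter (dist κ k) ≤ 2 * κ := by
  refine ciSup_le fun p => ?_
  rw [dist]
  have : √(κ ^ 2 - k p.1 p.2 ^ 2) ≤ κ := by
    rw [Real.sqrt_le_left hκ]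
    nlinarith [sq_nonneg (k p.1 p.2)]
  linarith

theorem regret_le_of_good (ha : 1 < a) (hu : 0 < u) (hD : 0 ≤ D) (hR : 0 < R) (hη : 0 < η)
    (hκ : 0 < κ) (hN : 1 ≤ N) (hk : ∀ x, k x x = κ) (hg : IsIIDGaussianProcess P g k)
    (hn : IsNoise P noise η g)
    (hcov : ∀ ε : ℝ, 0 < ε → ε ≤ R → (coveringNumber (dist κ k) ε : ℝ) ≤ (R / ε) ^ D)
    (hq : IsOptimistic k (dist κ k) η u a T (observation g noise q) q)
    (hC : ConfidenceHolds k η u a g noise T q ω) (hH : ChainingHolds (dist κ k) κ u g T ω)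
    {t : ℕ} (ht : 1 ≤ t) :
    regret (objective g) q t ω ≤ regretConstant a u D R κ η *
      (N * (√(t * maxInfoGain k η t * Real.log t) + maxInfoGain k η t) +
        √(N * t) * Real.log t) := by
  have hf := hg.isSubGammaProcess hk hN
  have hsymm := hg.kernel_comm ⟨0, hN⟩
  have hpsd : ∀ (m : ℕ) (xs : Fin m → X), (covMatrix k xs).PosSemidef := fun m xs =>
    hg.posSemidef_covMatrix ⟨0, hN⟩ xs
  have hvar : ∀ (m : ℕ) (xs : Fin m → X) (x : X), 0 ≤ posteriorVar k η xs x := fun m xs x =>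
    posteriorVar_nonneg hn hg xs ⟨0, hN⟩ x hη
  have hlog2 := Real.log_pos one_lt_two
  obtain ⟨K, hKdef⟩ : ∃ K, K = u + 2 * D + 3 := ⟨_, rfl⟩
  have hK : 0 < K := by rw [hKdef]; positivity
  obtain ⟨W, hWdef⟩ : ∃ W, W = 2 * K * (2 * κ + R) := ⟨_, rfl⟩
  have hW : 0 ≤ W := by rw [hWdef]; positivity
  obtain ⟨γ₀, hγ₀def⟩ : ∃ γ₀, γ₀ = 1 / 2 * Real.log (1 + κ / η ^ 2) := ⟨_, rfl⟩
  have hγ₀ : 0 < γ₀ := by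
    have : 0 < Real.log (1 + κ / η ^ 2) := Real.log_pos (by
      have : 0 < κ / η ^ 2 := by positivity
      linarith)
    rw [hγ₀def]; positivity
  obtain ⟨b, hbdef⟩ : ∃ b, b = 2 * (u + 2 * D * |Real.log R| +
    Real.log (riemannZeta (a : ℂ)).re) / Real.log 2 + 2 * (6 * D + a + 1) := ⟨_, rfl⟩
  have hb : 0 ≤ b := by
    have := Real.log_nonneg (one_le_zeta_re ha)
    rw [hbdef]; positivity
  obtain ⟨B, hBdef⟩ : ∃ B, B = 2 * Real.exp u * (κ + 1) + 4 * W := ⟨_, rfl⟩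
  have hB : 0 ≤ B := by rw [hBdef]; positivity
  have hS : 0 ≤ 2 * (η ^ 2 + κ) := by positivity
  obtain ⟨γ, hγdef⟩ : ∃ γ, γ = maxInfoGain k η t := ⟨_, rfl⟩
  have hγ : γ₀ ≤ γ := by
    rw [hγ₀def, hγdef]
    exact half_log_le_maxInfoGain hη hk hsymm hpsd hvar ht
  have hγ0 : 0 ≤ γ := hγ₀.le.trans hγ
  have hlogt : 0 ≤ Real.log t := Real.log_natCast_nonneg t
  have hmin : 0 < min γ₀ √(γ₀ * Real.log 2) := lt_min hγ₀ (Real.sqrt_pos.2 (by positivity))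
  obtain ⟨C₁, hC₁⟩ : ∃ C₁, C₁ = 8 * W / min γ₀ √(γ₀ * Real.log 2) := ⟨_, rfl⟩
  obtain ⟨C₂, hC₂⟩ : ∃ C₂, C₂ = 8 * (2 * K * (1 + 2 * √R)) / Real.log 2 := ⟨_, rfl⟩
  obtain ⟨C₃, hC₃⟩ : ∃ C₃, C₃ = 14 * W / Real.log 2 := ⟨_, rfl⟩
  obtain ⟨C₄, hC₄⟩ : ∃ C₄, C₄ = 4 * √B * √b * √(2 * (η ^ 2 + κ)) := ⟨_, rfl⟩
  have hC₁0 : 0 ≤ C₁ := by rw [hC₁]; positivity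
  have hC₂0 : 0 ≤ C₂ := by rw [hC₂]; positivity
  have hC₃0 : 0 ≤ C₃ := by rw [hC₃]; positivity
  have hC₄0 : 0 ≤ C₄ := by rw [hC₄]; positivity
  have hconst : regretConstant a u D R κ η = C₁ + C₂ + C₃ + C₄ := by
    rw [hC₁, hC₂, hC₃, hC₄, hBdef, hWdef, hγ₀def, hbdef, hKdef, regretConstant]
  rw [hconst, ← hγdef]
  obtain ⟨Y, hY⟩ : ∃ Y, Y = N * √(t * γ * Real.log t) := ⟨_, rfl⟩
  obtain ⟨Z, hZ⟩ : ∃ Z, Z = √(N * t) * Real.log t := ⟨_, rfl⟩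
  have hY0 : 0 ≤ Y := by rw [hY]; positivity
  have hZ0 : 0 ≤ Z := by rw [hZ]; positivity
  have hNγ : 0 ≤ N * γ := by positivity
  rw [← hZ, mul_add (N : ℝ), ← hY]
  rcases le_or_gt (diameter (dist κ k)) 0 with hΔ | hΔ
  · exact (regret_nonpos_of_diameter_eq_zero hH hf.dist_nonneg hΔ t).trans (by positivity)
  obtain ⟨hsub, hneg⟩ := objective_sub_le_and_neg_le hH hf.dist_self hf.dist_nonneg hR hD hu.le
    hcov hΔ
  obtain ⟨x, hx⟩ := regret_eq_sum (objective g) q t ω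
  obtain ⟨c, hc⟩ : ∃ c, c = chainConstant (dist κ k) N u D R := ⟨_, rfl⟩
  have hcM : ∀ M, diameter (dist κ k) * (1 + logRatio (dist κ k) R) ≤ M →
      c ≤ 2 * K * M * √N := by
    intro M hM
    calc c = 2 * K * (diameter (dist κ k) * (1 + logRatio (dist κ k) R)) * √N := by
          rw [hc, chainConstant, ← hKdef]; ring
      _ ≤ _ := by gcongr
  have hcW : c ≤ W * √N := by
    rw [hWdef]
    refine hcM _ ((diameter_mul_one_add_logRatio_le hR hΔ).trans ?_)
    linarith [diameter_dist_le hκ.le k]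
  have hr : regret (objective g) q t ω ≤ t * (8 * c) := by
    rw [hx]
    refine (Finset.sum_le_card_nsmul _ _ (8 * c) fun m _ => ?_).trans_eq (by simp)
    rw [hc]
    exact hsub _ _
  -- For `t ≤ N` the bound `t √N ≤ N √t` makes the crude estimate sufficient; for `t > N` the `log
  -- N` in the confidence factor is at most `log t`.
  rcases le_or_gt t N with htN | htN
  · have h := regret_bound_of_le_card hr hcW hW ht htN hγ₀ hγ
    rw [← hC₁, mul_add (N : ℝ), ← hY] at h
    refine h.trans ?_
    exact mul_le_mul (by linarith) (by linarith) (by positivity) (by positivity)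
  have ht2 : 2 ≤ t := by omega
  rcases le_or_gt (diameter (dist κ k)) (1 / t) with hΔt | hΔt
  · have h1 := hcM _ (diameter_mul_one_add_logRatio_le_of_le hR hΔ ht hΔt)
    have h := regret_bound_of_small (N := N) hr (W := 2 * K * (1 + 2 * √R)) (h1.trans_eq (by ring))
      (by positivity) ht2
    rw [← hC₂, ← hZ] at h
    refine h.trans ?_
    exact mul_le_mul (by linarith) (by linarith) (by positivity) (by positivity)
  · have hN1 : √(N : ℝ) ≤ N := by
      rw [Real.sqrt_le_left (Nat.cast_nonneg N)]
      have : (1 : ℝ) ≤ N := by exact_mod_cast hN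
      nlinarith
    have hnegB : ∀ x, -objective g x ω ≤ B * N := by
      intro x
      have h1 := hneg x
      rw [← hc] at h1
      have h2 : W * √N ≤ W * N := by gcongr
      rw [hBdef]
      linarith
    have hinst : ∀ m ∈ Finset.range t, objective g x ω - objective g (q m ω) ω ≤
        c * chainPotential (depth (m + 1)) +
          4 * confidenceFactor N (confidenceLevel (dist κ k) u a (m + 1)) *
          posteriorSD k η (fun l : Fin m => q l ω) (q m ω) * (√N * √(B * N)) := by
      intro m _
      obtain ⟨s, hs, hxs⟩ := exists_level_abs_objective_sub_le hH hf.dist_self hf.dist_nonneg hR hD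
        hu.le hcov hΔ x (depth (m + 1))
      rw [← hc] at hxs
      have h1 := objective_sub_query_le hC (hq.mem_level m ω) (hq.maximizes m ω) hs
      have h2 : √(-objective g (q m ω) ω) ≤ √(B * N) := Real.sqrt_le_sqrt (hnegB _)
      have h3 : 0 ≤ 4 * confidenceFactor N (confidenceLevel (dist κ k) u a (m + 1)) *
          posteriorSD k η (fun l : Fin m => q l ω) (q m ω) := by
        unfold confidenceFactor posteriorSD; positivity
      have h4 := mul_le_mul_of_nonneg_left
        (mul_le_mul_of_nonneg_left h2 (Real.sqrt_nonneg (N : ℝ))) h3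
      linarith [abs_le.1 hxs]
    have hσ : ∑ m ∈ Finset.range t, posteriorSD k η (fun l : Fin m => q l ω) (q m ω) ^ 2 ≤
        2 * (η ^ 2 + κ) * γ := by
      rw [hγdef]
      refine le_of_eq_of_le ?_ (sum_posteriorVar_le hη hk hsymm hpsd hvar (fun l => q l ω) t)
      exact Finset.sum_congr rfl fun m _ => Real.sq_sqrt (hvar m _ _)
    have hβ : ∀ m < t, confidenceFactor N (confidenceLevel (dist κ k) u a (m + 1)) ≤
        √(b * Real.log t) := by
      intro m hm
      rw [hbdef]
      exact Real.sqrt_le_sqrt (confidence_sq_le hf.dist_self hR hD ha hu.le hcov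
        (Nat.le_add_left 1 m) hm ht2 hN htN.le hΔt)
    have h := regret_bound_of_large (hx.trans_le (Finset.sum_le_sum hinst)) hcW hW ht2 hB hb hS
      hγ0 (fun m => Real.sqrt_nonneg _) hβ hσ
    rw [← hC₃, ← hC₄, ← hY, ← hZ] at h
    refine h.trans ?_
    calc C₃ * Z + C₄ * Y ≤ (C₁ + C₂ + C₃ + C₄) * Z + (C₁ + C₂ + C₃ + C₄) * Y := by
          gcongr <;> linarith
      _ = (C₁ + C₂ + C₃ + C₄) * (Y + Z) := by ring
      _ ≤ _ := by gcongr; linarith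

end Regret

lemma one_sub_le_measureReal {Ω : Type*} [MeasurableSpace Ω] {P : Measure Ω}
    [IsProbabilityMeasure P] {A B C : Ω → Prop} {δ : ℝ} (hδ : 0 ≤ δ)
    (hA : P {ω | ¬ A ω} ≤ ENNReal.ofReal δ) (hB : P {ω | ¬ B ω} ≤ ENNReal.ofReal δ)
    (h : ∀ ω, A ω → B ω → C ω) : 1 - 2 * δ ≤ P.real {ω | C ω} := by
  have hcover : (Set.univ : Set Ω) ⊆ {ω | C ω} ∪ ({ω | ¬ A ω} ∪ {ω | ¬ B ω}) := by
    intro ω _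
    by_cases hAω : A ω
    · by_cases hBω : B ω
      · exact Or.inl (h ω hAω hBω)
      · exact Or.inr (Or.inr hBω)
    · exact Or.inr (Or.inl hAω)
  have h1 : P.real (Set.univ : Set Ω) ≤
      P.real {ω | C ω} + (P.real {ω | ¬ A ω} + P.real {ω | ¬ B ω}) :=
    (measureReal_mono hcover).trans ((measureReal_union_le _ _).trans
      (add_le_add le_rfl (measureReal_union_le _ _)))
  have h2 : P.real {ω | ¬ A ω} ≤ δ := ENNReal.toReal_le_of_le_ofReal hδ hA
  have h3 : P.real {ω | ¬ B ω} ≤ δ := ENNReal.toReal_le_of_le_ofReal hδ hB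
  rw [probReal_univ] at h1
  linarith

end SquaredGP

end

theorem mainTheorem5 :
    -- sub-Gamma smoothness, over an arbitrary index set
    (∀ {Ω : Type*} [MeasurableSpace Ω] (P : Measure Ω) [IsProbabilityMeasure P]
        {X : Type*} (N : ℕ) (κ : ℝ) (k : X → X → ℝ) (g : Fin N → X → Ω → ℝ),
        (∀ x, k x x = κ) → SquaredGP.IsIIDGaussianProcess P g k → 1 ≤ N →
        SquaredGP.IsSubGammaProcess P (SquaredGP.objective g) (SquaredGP.dist κ k) N 1) ∧
    -- regret bound, with a constant that depends on `a, u, D, R, κ, η` only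
    (∀ (a u D R κ η : ℝ), 1 < a → 0 < u → 0 ≤ D → 0 < R → 0 < η →
      ∃ C : ℝ, ∀ {Ω : Type*} [MeasurableSpace Ω] (P : Measure Ω) [IsProbabilityMeasure P]
        {X : Type*} [Fintype X] [Nonempty X]
        (N : ℕ) (k : X → X → ℝ) (g : Fin N → X → Ω → ℝ) (noise : ℕ → Fin N → Ω → ℝ)
        (T : SquaredGP.ChainingTree (SquaredGP.dist κ k)) (q : ℕ → Ω → X),
        1 ≤ N →
        (∀ x, k x x = κ) →
        SquaredGP.IsIIDGaussianProcess P g k →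
        SquaredGP.IsNoise P noise η g →
        (∀ ε : ℝ, 0 < ε → ε ≤ R →
          (SquaredGP.coveringNumber (SquaredGP.dist κ k) ε : ℝ) ≤ (R / ε) ^ D) →
        SquaredGP.IsOptimistic k (SquaredGP.dist κ k) η u a T
          (SquaredGP.observation g noise q) q →
        1 - 2 * Real.exp (-u) ≤
          P.real {ω | ∀ t : ℕ, 1 ≤ t →
            SquaredGP.regret (SquaredGP.objective g) q t ω ≤
              C * (N * (Real.sqrt (t * SquaredGP.maxInfoGain k η t * Real.log t)
                      + SquaredGP.maxInfoGain k η t)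
                    + Real.sqrt (N * t) * Real.log t)}) := by
  refine ⟨fun P _ X N κ k g hk hg hN => hg.isSubGammaProcess hk hN, ?_⟩
  intro a u D R κ η ha hu hD hR hη
  -- A variance cannot be negative, so `κ ≤ 0` means `κ = 0`. Then `d = 0`, the regret is at most 0
  -- on the chaining event, and `C = 0` works; the general constant would involve division by `γ₀ =
  -- 0`.
  refine ⟨if 0 < κ then SquaredGP.regretConstant a u D R κ η else 0, ?_⟩
  intro Ω _ P _ X _ _ N k g noise T q hN hk hg hn hcov hq
  refine SquaredGP.one_sub_le_measureReal (Real.exp_pos _).le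
    (SquaredGP.measure_not_confidenceHolds_le hn hg hη hN hu.le ha T hq.adapted)
    (SquaredGP.measure_not_chainingHolds_le hg hk hN u T) fun ω hC hH t ht => ?_
  split_ifs with hκ
  · exact SquaredGP.regret_le_of_good ha hu hD hR hη hκ hN hk hg hn hcov hq hC hH ht
  · have hκ0 := hg.kernel_self_nonneg hk ⟨0, hN⟩ (Classical.arbitrary X)
    rw [zero_mul]
    exact SquaredGP.regret_nonpos_of_diameter_eq_zero hH
      (hg.isSubGammaProcess hk hN).dist_nonneg
      ((SquaredGP.diameter_dist_le hκ0 k).trans (by linarith)) t
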